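/- **Setting.** Let $f:\mathbb R^{d_x}\times\mathbb R^{d_u}\to\mathbb R^{d_x}$ be Borel measurable, let $1\le \tau_{\rm obs}\le\tau_{\rm chunk}$ and $H$ be integers, $T=H\tau_{\rm chunk}$, $t_h=(h-1)\tau_{\rm chunk}+1$. A trajectory of length $n$ is $\rho=(x_{1:n+1},u_{1:n})$ with $x_t\in\mathbb R^{d_x}$, $u_t\in\mathbb R^{d_u}$; put $d_{\rm traj}(\rho,\rho')=\max\{\max_t\|x_t-x_t'\|,\max_t\|u_t-u'_t\|\}$. The expert law $D_{\exp}$ is a probability measure on trajectories of length $T$ that almost surely satisfy $x_{t+1}=f(x_t,u_t)$. The observation chunk at $h$ is $o_h=(x_{t_h-\tau_{\rm obs}+1:t_h},u_{t_h-\tau_{\rm obs}+1:t_h-1})$, with zeros at times $<1$. A primitive controller is $\kappa=(\bar u,\bar x,\bar K)$, acting by $\kappa(x)=\bar u+\bar K(x-\bar x)$; a composite action is $\mathsf a=(\kappa_1,\dots,\kappa_{\tau_{\rm chunk}})$, and $d_{\max}(\mathsf a,\mathsf a')=\max_k(\|\bar u_k-\bar u_k'\|+\|\bar x_k-\bar x'_k\|+\|\bar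 K_k-\bar K'_k\|)$ (Euclidean and operator norms). A synthesis oracle is a measurable map $\mathtt{synth}$ from trajectories of length $T$ to sequences $\kappa_{1:T}$; put $\mathsf a_h=\kappa_{t_h:t_{h+1}-1}$. Let $D_{\exp,h}$ be the law of $(\mathsf a_h,o_h)$ for $\rho\sim D_{\exp}$, $\kappa_{1:T}=\mathtt{synth}(\rho)$, and let $\pi^\star_h$ be any regular conditional distribution of $\mathsf a_h$ given $o_h$ under $D_{\exp,h}$. A chunking policy $\pi=(\pi_h)_{h\le H}$ consists of probability kernels from observation chunks to composite actions. It induces a trajectory law $D_\pi$: draw $x_1$ from its law under $D_{\exp}$; for each $h$ draw $\mathsf a_h\sim\pi_h(o_h)$, and set $u_t=\kappa_t(x_t)$, $x_{t+1}=f(x_t,u_t)$ for $t_h\le t<t_{h+1}$. The policy is $\gamma$-TVC, for $\gamma:\mathbb R_{\ge0}\to\mathbb R_{\ge0}$, if $\mathsf{TV}(\pi_h(o),\pi_h(o'))\le\gamma(d_{\rm traj}(o,o'))$ for all $h,o,o'$, where $\mathsf{TV}(P,Q)=\sup_A|P(A)-Q(A)|$. Define $$\Gamma_{\mathrm{marg},\epsilon}(\pi)=\max_{1\le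 t\le T}\ \inf_{\mu}\ \Pr_\mu\big[\max\{\|x^{\exp}_{t+1}-x^\pi_{t+1}\|,\|u^{\exp}_t-u^\pi_t\|\}>\epsilon\big],$$ with $\mu$ ranging over all couplings of $D_{\exp}$ and $D_\pi$. For laws $P,Q$ of composite actions let $\Delta_r(P,Q)=\inf_\mu\Pr_\mu[d_{\max}(\mathsf a,\mathsf a')>r]$ and $W_{1,d_{\max}}(P,Q)=\inf_\mu\mathbb E_\mu[d_{\max}(\mathsf a,\mathsf a')]\in[0,\infty]$, the infima being over couplings of $P$ and $Q$. **Local t-ISS.** Given $\mathsf a=(\kappa_1,\dots,\kappa_\tau)$, $\xi\in\mathbb R^{d_x}$ and $\delta u_{1:\tau}\in(\mathbb R^{d_u})^\tau$, let $x^{\mathsf a}_1=\xi$ and $x^{\mathsf a}_{i+1}=f(x^{\mathsf a}_i,\kappa_i(x^{\mathsf a}_i)+\delta u_i)$. Then $\mathsf a$ is local t-ISS at $\xi_0$ with moduli $\gamma,\beta$ and parameters $c_u,c_\xi$ if for all $\xi,\xi',\delta u_{1:\tau}$ with $\|\xi-\xi_0\|,\|\xi'-\xi_0\|\le c_\xi$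 and $\max_s\|\delta u_s\|\le c_u$, and all $1\le i\le\tau+1$, $$\|x^{\mathsf a}_i(0,\xi)-x^{\mathsf a}_i(\delta u_{1:\tau},\xi')\|\le\beta(\|\xi-\xi'\|,i)+\gamma\Big(\max_{1\le s\le i-1}\|\delta u_s\|\Big),$$ the maximum of the empty set being $0$. **Assumption.** There are $c_u,c_\xi,\bar c_\gamma,\bar c_\beta>0$, $L_\beta\in(0,1]$, $R_{\rm dyn}$ and $R_K$ such that, almost surely for $\rho=(x_{1:T+1},u_{1:T})\sim D_{\exp}$ and $\kappa_{1:T}=\mathtt{synth}(\rho)$: $\bar x_t=x_t$ and $\bar u_t=u_t$ for all $t\le T$; for every $h$, $\mathsf a_h$ is local t-ISS at $x_{t_h}$ with parameters $c_u,c_\xi$ and moduli $\gamma(r)=\bar c_\gamma r$, $\beta(r,k)=\bar c_\beta e^{-(k-1)L_\beta}r$; and $\|x_t\|,\|u_t\|\le R_{\rm dyn}$, $\|\bar K_t\|\le R_K$ for all $t$. **Constants.** Let $\epsilon_0=\min\{c_u,c_\xi/(4\bar c_\gamma)\}$, $\alpha=\bar c_\beta(4\bar c_\gamma\epsilon_0+c_\xi)$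 and $$c_1=\big(1+4\bar c_\gamma\bar c_\beta(1+R_K)\big)\big(2+\alpha+R_K+2R_{\rm dyn}\big),\quad c_2=\min\Big\{1,\frac{\epsilon_0}{\max\{1,c_1\}}\Big\},\quad c_3=\frac{\log(2e\bar c_\beta)}{L_\beta}.$$ **Theorem.** Suppose the Assumption holds, $0\le\epsilon<c_2$ and $\tau_{\rm chunk}\ge c_3$. Then for every non-decreasing $\gamma_{\rm TVC}:\mathbb R_{\ge0}\to\mathbb R_{\ge0}$ and every $\gamma_{\rm TVC}$-TVC chunking policy $\hat\pi$, $$\Gamma_{\mathrm{marg},\epsilon}(\hat\pi)\le H\gamma_{\rm TVC}(\epsilon)+\sum_{h=1}^H\mathbb E_{o_h\sim D_{\exp,h}}\big[\Delta_{\epsilon/c_1}(\pi^\star_h(o_h),\hat\pi_h(o_h))\big],$$ and, if $\epsilon>0$, $$\sum_{h=1}^H\mathbb E_{o_h\sim D_{\exp,h}}\big[\Delta_{\epsilon/c_1}(\pi^\star_h(o_h),\hat\pi_h(o_h))\big]\le\frac{c_1}{\epsilon}\sum_{h=1}^H\mathbb E_{o_h\sim D_{\exp,h}}\big[W_{1,d_{\max}}(\pi^\star_h(o_h),\hat\pi_h(o_h))\big].$$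 -/

import Mathlib

open MeasureTheory ProbabilityTheory Finset
open scoped NNReal ENNReal

noncomputable section

/-- The Euclidean space of dimension `d`. -/
abbrev Vec (d : ℕ) : Type := EuclideanSpace ℝ (Fin d)

/-- A primitive (affine) controller, as a triple `(uBar, xBar, KBar)`. -/
abbrev PrimCtrl (dx du : ℕ) : Type := Vec du × Vec dx × (Vec dx →L[ℝ] Vec du)

/-- The input that the controller plays at the state `x`, namely `uBar + KBar (x - xBar)`. -/
def applyCtrl {dx du : ℕ} (κ : PrimCtrl dx du) (x : Vec dx) : Vec du :=
  κ.1 + κ.2.2 (x - κ.2.1)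

/-- A composite action (chunk): `τ` primitive controllers, played one after the other. -/
abbrev CompAct (dx du τ : ℕ) : Type := Fin τ → PrimCtrl dx du

/-- Trajectories with `n + 1` states and `n` inputs. Times are counted from `0`. -/
abbrev Traj (dx du n : ℕ) : Type := (Fin (n + 1) → Vec dx) × (Fin n → Vec du)

/-- The state at time `t` (`0` beyond the end of the trajectory). -/
def stateAt {dx du n : ℕ} (ρ : Traj dx du n) (t : ℕ) : Vec dx :=
  if h : t < n + 1 then ρ.1 ⟨t, h⟩ else 0

/-- The input at time `t` (`0` beyond the end of the trajectory). -/
def inputAt {dx du n : ℕ} (ρ : Traj dx du n) (t : ℕ) : Vec du :=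
  if h : t < n then ρ.2 ⟨t, h⟩ else 0

theorem measurable_stateAt {dx du n : ℕ} (t : ℕ) :
    Measurable (fun ρ : Traj dx du n => stateAt ρ t) := by
  unfold stateAt
  split_ifs with h
  · exact (measurable_pi_apply _).comp measurable_fst
  · exact measurable_const

theorem measurable_inputAt {dx du n : ℕ} (t : ℕ) :
    Measurable (fun ρ : Traj dx du n => inputAt ρ t) := by
  unfold inputAt
  split_ifs with h
  · exact (measurable_pi_apply _).comp measurable_snd
  · exact measurable_const

/-- The observation chunk at the start of chunk `h`: the last `τobs` states up to and including
time `h * τ`, and the `τobs - 1` inputs between them. Entries at negative times are `0`. -/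
def obsChunk {dx du n : ℕ} (τ τobs h : ℕ) (ρ : Traj dx du n) : Traj dx du (τobs - 1) :=
  (fun j => if τobs ≤ h * τ + j + 1 then stateAt ρ (h * τ + j + 1 - τobs) else 0,
   fun j => if τobs ≤ h * τ + j + 1 then inputAt ρ (h * τ + j + 1 - τobs) else 0)

theorem measurable_obsChunk {dx du n : ℕ} (τ τobs h : ℕ) :
    Measurable (fun ρ : Traj dx du n => obsChunk τ τobs h ρ) := by
  unfold obsChunk
  refine Measurable.prodMk (measurable_pi_lambda _ fun j => ?_) (measurable_pi_lambda _ fun j => ?_)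
  · split_ifs
    · exact measurable_stateAt _
    · exact measurable_const
  · split_ifs
    · exact measurable_inputAt _
    · exact measurable_const

/-- The time of step `k` of chunk `h`. -/
def chunkIdx {H τ : ℕ} (h : Fin H) (k : Fin τ) : Fin (H * τ) :=
  ⟨h * τ + k, by
    calc (h : ℕ) * τ + k < h * τ + τ := Nat.add_lt_add_left k.2 _
      _ = (h + 1) * τ := by ring
      _ ≤ H * τ := Nat.mul_le_mul_right _ h.2⟩

/-- Chunk `h` of a sequence of `H * τ` primitive controllers. -/
def chunkAct {dx du H τ : ℕ} (h : Fin H) (κ : Fin (H * τ) → PrimCtrl dx du) : CompAct dx du τ :=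
  fun k => κ (chunkIdx h k)

/-- The states that arise from the state `ξ` at step `0` when the composite action `a` is played,
with the additive input perturbation `δu`, through the dynamics `f` (constant after step `τ`). -/
def rollout {dx du τ : ℕ} (f : Vec dx → Vec du → Vec dx) (a : CompAct dx du τ)
    (δu : Fin τ → Vec du) (ξ : Vec dx) : ℕ → Vec dx
  | 0 => ξ
  | k + 1 =>
      if hk : k < τ then
        f (rollout f a δu ξ k) (applyCtrl (a ⟨k, hk⟩) (rollout f a δu ξ k) + δu ⟨k, hk⟩)
      else rollout f a δu ξ k

/-- Local time-varying incremental input-to-state stability of `a` at `ξ0`, with gain `γ`, decay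
`β` and radii `cu` (inputs), `cξ` (initial states). With steps counted from `1`, step `i = k + 1`
compares the unperturbed rollout from `ξ` with the perturbed one from `ξ'`; the maximum of the
perturbations played before that step is `0` when there are none. -/
def IsLocalTISS {dx du τ : ℕ} (f : Vec dx → Vec du → Vec dx)
    (γ : ℝ → ℝ) (β : ℝ → ℕ → ℝ) (cu cξ : ℝ) (a : CompAct dx du τ) (ξ0 : Vec dx) : Prop :=
  ∀ (ξ ξ' : Vec dx) (δu : Fin τ → Vec du),
    ‖ξ - ξ0‖ ≤ cξ → ‖ξ' - ξ0‖ ≤ cξ → (∀ s, ‖δu s‖ ≤ cu) →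
    ∀ k : ℕ, k ≤ τ →
      ‖rollout f a 0 ξ k - rollout f a δu ξ' k‖ ≤
        β ‖ξ - ξ'‖ (k + 1) +
          γ (((univ.filter fun s : Fin τ => (s : ℕ) < k).sup fun s => ‖δu s‖₊ : ℝ≥0) : ℝ)

/-- The scalars of the stability assumption: the radii `cu`, `cξ`, the coefficients `cγ`, `cβ` of
the gain and of the decay, the decay rate `L`, the bound `Rdyn` on states and inputs, and the
bound `RK` on feedback gains. -/
structure StabParams where
  cu : ℝ
  cξ : ℝ
  cγ : ℝ
  cβ : ℝ
  L : ℝ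
  Rdyn : ℝ
  RK : ℝ

namespace StabParams

/-- The gain `γ(r) = cγ r`. -/
def gain (p : StabParams) : ℝ → ℝ := fun r => p.cγ * r

/-- The decay `β(r, i) = cβ exp(-L (i - 1)) r`. -/
def decay (p : StabParams) : ℝ → ℕ → ℝ := fun r i =>
  p.cβ * Real.exp (-(p.L * ((i : ℝ) - 1))) * r

/-- The radius `min {cu, cξ / (4 cγ)}`. -/
def radius (p : StabParams) : ℝ := min p.cu (p.cξ / (4 * p.cγ))

/-- `α = cβ (4 cγ radius + cξ)`. -/
def spread (p : StabParams) : ℝ := p.cβ * (4 * p.cγ * p.radius + p.cξ)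

def c1 (p : StabParams) : ℝ :=
  (1 + 4 * p.cγ * p.cβ * (1 + p.RK)) * (2 + p.spread + p.RK + 2 * p.Rdyn)

def c2 (p : StabParams) : ℝ := min 1 (p.radius / max 1 p.c1)

def c3 (p : StabParams) : ℝ := Real.log (2 * Real.exp 1 * p.cβ) / p.L

end StabParams

/-- The stability assumption on the expert law `D` and the synthesis oracle `synth`: almost surely
the synthesized controllers are consistent with the trajectory, every composite action is locally
stable at the state where its chunk starts, and everything is bounded. -/
structure StabilityAssumption {dx du H τ : ℕ} (f : Vec dx → Vec du → Vec dx)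
    (D : Measure (Traj dx du (H * τ)))
    (synth : Traj dx du (H * τ) → Fin (H * τ) → PrimCtrl dx du) (p : StabParams) : Prop where
  cu_pos : 0 < p.cu
  cξ_pos : 0 < p.cξ
  cγ_pos : 0 < p.cγ
  cβ_pos : 0 < p.cβ
  L_pos : 0 < p.L
  L_le_one : p.L ≤ 1
  consistent : ∀ᵐ ρ ∂D, ∀ t : Fin (H * τ),
    (synth ρ t).1 = ρ.2 t ∧ (synth ρ t).2.1 = ρ.1 t.castSucc
  stable : ∀ᵐ ρ ∂D, ∀ h : Fin H,
    IsLocalTISS f p.gain p.decay p.cu p.cξ (chunkAct h (synth ρ)) (stateAt ρ (h * τ))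
  states_bounded : ∀ᵐ ρ ∂D, ∀ t, ‖ρ.1 t‖ ≤ p.Rdyn
  inputs_bounded : ∀ᵐ ρ ∂D, ∀ t, ‖ρ.2 t‖ ≤ p.Rdyn
  gains_bounded : ∀ᵐ ρ ∂D, ∀ t, ‖(synth ρ t).2.2‖ ≤ p.RK

/-- The distance between composite actions: the largest, over the steps, sum of the distances of
the three components (Euclidean, Euclidean, operator norm). -/
def dMax {dx du τ : ℕ} (a b : CompAct dx du τ) : ℝ≥0 :=
  univ.sup fun k => nndist (a k).1 (b k).1 + nndist (a k).2.1 (b k).2.1 +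
    nndist (a k).2.2 (b k).2.2

/-- The distance between trajectories: the largest distance of states or of inputs. -/
def dTraj {dx du n : ℕ} (ρ ρ' : Traj dx du n) : ℝ≥0 :=
  max (univ.sup fun t => nndist (ρ.1 t) (ρ'.1 t)) (univ.sup fun t => nndist (ρ.2 t) (ρ'.2 t))

/-- `μ` is a coupling of `P` and `Q`. -/
def IsCoupling {A B : Type*} [MeasurableSpace A] [MeasurableSpace B]
    (μ : Measure (A × B)) (P : Measure A) (Q : Measure B) : Prop :=
  μ.map Prod.fst = P ∧ μ.map Prod.snd = Q

/-- `Δ_r(P, Q)`, the infimum over couplings of the probability that `dMax` exceeds `r`. -/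
def otProb {dx du τ : ℕ} (r : ℝ) (P Q : Measure (CompAct dx du τ)) : ℝ≥0∞ :=
  ⨅ (μ : Measure (CompAct dx du τ × CompAct dx du τ)) (_ : IsCoupling μ P Q),
    μ {z | r < (dMax z.1 z.2 : ℝ)}

/-- The `1`-Wasserstein distance for `dMax`. -/
def wass1 {dx du τ : ℕ} (P Q : Measure (CompAct dx du τ)) : ℝ≥0∞ :=
  ⨅ (μ : Measure (CompAct dx du τ × CompAct dx du τ)) (_ : IsCoupling μ P Q),
    ∫⁻ z, (dMax z.1 z.2 : ℝ≥0∞) ∂μ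

/-- The total variation distance, the supremum over measurable `S` of `|P S - Q S|`. It is
meant for probability measures. -/
def tvDist {A : Type*} [MeasurableSpace A] (P Q : Measure A) : ℝ :=
  ⨆ S : {S : Set A // MeasurableSet S}, |P.real S.1 - Q.real S.1|

/-- A chunking policy: for each chunk a kernel from observation chunks to composite actions. -/
abbrev ChunkPolicy (dx du H τ τobs : ℕ) : Type :=
  Fin H → Kernel (Traj dx du (τobs - 1)) (CompAct dx du τ)

/-- `γ`-total-variation continuity of a chunking policy. -/
def IsTVC {dx du H τ τobs : ℕ} (γ : ℝ≥0 → ℝ≥0) (π : ChunkPolicy dx du H τ τobs) : Prop :=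
  ∀ (h : Fin H) (o o' : Traj dx du (τobs - 1)), tvDist (π h o) (π h o') ≤ γ (dTraj o o')

/-- The trajectory with initial state `x` and zeros elsewhere. -/
def initTraj {dx du : ℕ} (n : ℕ) (x : Vec dx) : Traj dx du n :=
  (fun t => if (t : ℕ) = 0 then x else 0, 0)

/-- Play the composite action `a` during chunk `h`, that is at the times `h * τ + k` with `k < τ`,
from the current state at time `h * τ`; the rest of the trajectory is left as it is. -/
def execChunk {dx du n τ : ℕ} (f : Vec dx → Vec du → Vec dx) (h : ℕ) (ρ : Traj dx du n)
    (a : CompAct dx du τ) : Traj dx du n :=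
  (fun t =>
    if h * τ < (t : ℕ) ∧ (t : ℕ) ≤ h * τ + τ then
      rollout f a 0 (stateAt ρ (h * τ)) ((t : ℕ) - h * τ)
    else ρ.1 t,
   fun t =>
    if hk : h * τ ≤ (t : ℕ) ∧ (t : ℕ) - h * τ < τ then
      applyCtrl (a ⟨(t : ℕ) - h * τ, hk.2⟩)
        (rollout f a 0 (stateAt ρ (h * τ)) ((t : ℕ) - h * τ))
    else ρ.2 t)

/-- The law of the trajectory after the first `m` chunks have been played by the policy `π` from
an initial state with law `ν`. In chunk `m` the action is drawn from `π` at the current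
observation chunk and is then played through the dynamics. -/
def partialLaw {dx du H τ τobs : ℕ} (f : Vec dx → Vec du → Vec dx) (ν : Measure (Vec dx))
    (π : ChunkPolicy dx du H τ τobs) : ℕ → Measure (Traj dx du (H * τ))
  | 0 => ν.map (initTraj (H * τ))
  | m + 1 =>
      if hm : m < H then
        (partialLaw f ν π m ⊗ₘ
            (π ⟨m, hm⟩).comap (fun ρ : Traj dx du (H * τ) => obsChunk τ τobs m ρ)
              (measurable_obsChunk τ τobs m)).map
          (fun z => execChunk f m z.1 z.2)
      else partialLaw f ν π m

/-- The law of the trajectory of the policy `π`, started from the initial-state law of `D`. -/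
def policyLaw {dx du H τ τobs : ℕ} (f : Vec dx → Vec du → Vec dx)
    (D : Measure (Traj dx du (H * τ))) (π : ChunkPolicy dx du H τ τobs) :
    Measure (Traj dx du (H * τ)) :=
  partialLaw f (D.map fun ρ => ρ.1 0) π H

/-- The marginal imitation loss between two trajectory laws: the largest, over times, infimum over
couplings of the probability that the next states or the current inputs differ by more
than `ε`. -/
def margLoss {dx du n : ℕ} (ε : ℝ) (D D' : Measure (Traj dx du n)) : ℝ≥0∞ :=
  ⨆ t : Fin n, ⨅ (μ : Measure (Traj dx du n × Traj dx du n)) (_ : IsCoupling μ D D'),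
    μ {z | ε < max ‖z.1.1 t.succ - z.2.1 t.succ‖ ‖z.1.2 t - z.2.2 t‖}

/-- The joint law of the observation chunk and the composite action of the expert at chunk `h`. -/
def expertChunkLaw {dx du H τ : ℕ} (τobs : ℕ) (D : Measure (Traj dx du (H * τ)))
    (synth : Traj dx du (H * τ) → Fin (H * τ) → PrimCtrl dx du) (h : Fin H) :
    Measure (Traj dx du (τobs - 1) × CompAct dx du τ) :=
  D.map fun ρ => (obsChunk τ τobs h ρ, chunkAct h (synth ρ))

end

/-! ### Stability of a single chunk -/

/-! A single chunk is controlled by stability, the passage from chunk to chunk by coupling.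

Stability (`chunk_close`). Playing `b` instead of the expert action `a` is playing `a` with an input
perturbation. If `dMax a b ≤ r` and the states stay within `spread`, the perturbation is at most `U
= pert r`; local t-ISS then keeps the states within `3 cγ cβ U ≤ spread`, so the two bounds sustain
each other. Over a chunk of length `τ ≥ c3` an initial discrepancy `2 cγ U` contributes at most half
of itself at the end, and the perturbation at most `cγ U`, so the chunk ends within `2 cγ U` again
and errors do not accumulate. At `r = actRadius ε` all deviations are at most `ε`.

Coupling (`exists_coupling_succ`). The induction carries a coupling of the full expert law with the
law of the policy after `m` chunks, and records only that the current observations are close. For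
the next chunk both actions are drawn jointly, and the whole expert trajectory is redrawn given its
observation and its action (`exists_step`); the law `D` survives because `πstar` is the conditional
law of the action. Redrawing forgets past closeness, so different times use different couplings,
which the marginal loss permits. The joint draw couples `πstar o` with `πhat o` almost optimally for
`otProb`, then moves `πhat o` to `πhat o'` at a cost of their total variation, at most `γ ε`
(`exists_coupling_kernel_obs`). Summing over chunks gives the first bound.

The almost optimal couplings must depend measurably on `o`. For `ε > 0`,
`exists_coupling_kernel_otProb` cuts the action space into countably many small cells and selects
among countably many rational plans between cells; the resulting loss of radius fits into the gap `ε
/ c1 < actRadius ε`. For `ε = 0` there is no gap, but `otProb 0` dominates total variation, and the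
overlap of the two laws gives an explicit coupling. The Wasserstein bound is Markov's inequality. -/

theorem norm_applyCtrl_sub_le {dx du : ℕ} {κ κ' : PrimCtrl dx du} {y : Vec dx} {r α R : ℝ}
    (h : (nndist κ.1 κ'.1 + nndist κ.2.1 κ'.2.1 + nndist κ.2.2 κ'.2.2 : ℝ) ≤ r) (hr : r ≤ 1)
    (hR : ‖κ.2.2‖ ≤ R) (hy : ‖y - κ.2.1‖ ≤ α) :
    ‖applyCtrl κ' y - applyCtrl κ y‖ ≤ r * (1 + α + R) := by
  obtain ⟨u, x, K⟩ := κ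
  obtain ⟨u', x', K'⟩ := κ'
  simp only [coe_nndist, dist_eq_norm] at h hR hy
  -- The gain difference multiplies `y - x`, which is at most `α`, and `K'` multiplies the
  -- difference of centres. Since `r ≤ 1`, `‖K'‖ ≤ R + 1`, so the common factor `1 + α + R` covers
  -- all three terms.
  have hdecomp : applyCtrl (u', x', K') y - applyCtrl (u, x, K) y =
      (u' - u) + (K' - K) (y - x) + K' (x - x') := by
    simp only [applyCtrl, map_sub, sub_apply]
    abel
  have h1 : ‖u' - u‖ = ‖u - u'‖ := norm_sub_rev _ _
  have h2 : ‖K' - K‖ = ‖K - K'‖ := norm_sub_rev _ _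
  have hα : 0 ≤ α := (norm_nonneg _).trans hy
  have hK : ‖(K' - K) (y - x)‖ ≤ ‖K - K'‖ * α := by
    rw [← h2]
    exact (ContinuousLinearMap.le_opNorm _ _).trans (by gcongr)
  have hK' : ‖K'‖ ≤ R + ‖K - K'‖ := by
    have : K' = K - (K - K') := by abel
    calc ‖K'‖ = ‖K - (K - K')‖ := by rw [← this]
      _ ≤ ‖K‖ + ‖K - K'‖ := norm_sub_le _ _
      _ ≤ _ := by gcongr
  have hx : ‖K' (x - x')‖ ≤ (R + ‖K - K'‖) * ‖x - x'‖ :=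
    (ContinuousLinearMap.le_opNorm _ _).trans (by gcongr)
  have hR0 : 0 ≤ R := (norm_nonneg _).trans hR
  have n1 := norm_nonneg (u - u')
  have n2 := norm_nonneg (x - x')
  have n3 := norm_nonneg (K - K')
  have hk1 : ‖K - K'‖ ≤ 1 := by linarith
  rw [hdecomp]
  calc _ ≤ ‖u' - u‖ + ‖(K' - K) (y - x)‖ + ‖K' (x - x')‖ := norm_add₃_le
    _ ≤ ‖u - u'‖ + ‖K - K'‖ * α + (R + 1) * ‖x - x'‖ := by
        rw [h1]
        have := mul_le_mul_of_nonneg_right hk1 n2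
        linarith
    _ ≤ (‖u - u'‖ + ‖x - x'‖ + ‖K - K'‖) * (1 + α + R) := by
        have := mul_nonneg n1 (add_nonneg hα hR0)
        have := mul_nonneg n2 hα
        have := mul_nonneg n3 (add_nonneg zero_le_one hR0)
        linarith
    _ ≤ _ := by gcongr

theorem rollout_congr {dx du τ : ℕ} (f : Vec dx → Vec du → Vec dx) (a : CompAct dx du τ)
    {δ δ' : Fin τ → Vec du} (ξ : Vec dx) {k : ℕ} (h : ∀ s : Fin τ, (s : ℕ) < k → δ s = δ' s) :
    rollout f a δ ξ k = rollout f a δ' ξ k := by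
  induction k with
  | zero => rfl
  | succ k ih =>
    have ih' := ih fun s hs => h s (by omega)
    by_cases hk : k < τ
    · simp only [rollout, hk, dite_true, ih', h ⟨k, hk⟩ (Nat.lt_succ_self k)]
    · simp only [rollout, hk, dite_false, ih']

/-- Playing `b` amounts to playing `a` with the difference of the inputs as a perturbation. -/
theorem rollout_eq_rollout_perturbed {dx du τ : ℕ} (f : Vec dx → Vec du → Vec dx)
    (a b : CompAct dx du τ) (ξ : Vec dx) (k : ℕ) :
    rollout f a (fun s => applyCtrl (b s) (rollout f b 0 ξ s) -
      applyCtrl (a s) (rollout f b 0 ξ s)) ξ k = rollout f b 0 ξ k := by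
  induction k with
  | zero => rfl
  | succ k ih =>
    by_cases hk : k < τ
    · simp only [rollout, hk, dite_true, ih]
      simp
    · simp only [rollout, hk, dite_false, ih]

namespace StabParams

/-- The bound on the input perturbation caused by an action at distance at most `r`. -/
noncomputable def pert (p : StabParams) (r : ℝ) : ℝ := r * (1 + p.spread + p.RK)

end StabParams

/-- At step `0` nothing has been played, so stability reads `‖ξ - ξ'‖ ≤ cβ ‖ξ - ξ'‖`; any nonzero
displacement forces `1 ≤ cβ`. The bootstrap in `chunk_close` uses this to absorb `cγ U` into `cβ cγ
U`. -/
theorem subsingleton_or_one_le_of_isLocalTISS {dx du τ : ℕ} {f : Vec dx → Vec du → Vec dx}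
    {p : StabParams} {a : CompAct dx du τ} {ξ : Vec dx}
    (hcu : 0 < p.cu) (hcξ : 0 < p.cξ) (ha : IsLocalTISS f p.gain p.decay p.cu p.cξ a ξ) :
    Subsingleton (Vec dx) ∨ 1 ≤ p.cβ := by
  rcases subsingleton_or_nontrivial (Vec dx) with hs | hn
  · exact Or.inl hs
  right
  obtain ⟨v, hv⟩ := exists_norm_eq (Vec dx) hcξ.le
  have := ha ξ (ξ + v) 0 (by simpa using hcξ.le) (by simp [hv]) (fun _ => by simpa using hcu.le) 0
    (Nat.zero_le _)
  simp [rollout, StabParams.gain, StabParams.decay, hv] at this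
  exact (le_mul_iff_one_le_left hcξ).1 this

theorem gain_sup_le {du τ : ℕ} {p : StabParams} (hcγ : 0 < p.cγ) {δ : Fin τ → Vec du}
    {U : ℝ} (hU : 0 ≤ U) (k : ℕ) (h : ∀ s : Fin τ, (s : ℕ) < k → ‖δ s‖ ≤ U) :
    p.gain (((univ.filter fun s : Fin τ => (s : ℕ) < k).sup fun s => ‖δ s‖₊ : ℝ≥0) : ℝ) ≤
      p.cγ * U := by
  unfold StabParams.gain
  gcongr
  lift U to ℝ≥0 using hU
  exact_mod_cast Finset.sup_le fun s hs => by
    have := h s (by simpa using hs)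
    exact_mod_cast this

/-- A bootstrap over the steps: closeness of earlier states bounds the earlier perturbations by
`pert r`, and stability turns this into closeness of the next state. By `hcons` the feedback centres
of `a` are its own states, so the deviation of states is also the distance to the centres. The last
bound has the form of the hypothesis on `‖ξ - ξ'‖`, so the estimate can be iterated over chunks. -/
theorem chunk_close {dx du τ : ℕ} {f : Vec dx → Vec du → Vec dx} {p : StabParams}
    {a b : CompAct dx du τ} {ξ ξ' : Vec dx} {r : ℝ}
    (hcu : 0 < p.cu) (hcξ : 0 < p.cξ) (hcγ : 0 < p.cγ) (hcβ : 0 < p.cβ) (hL : 0 < p.L)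
    (hRK : 0 ≤ p.RK)
    (ha : IsLocalTISS f p.gain p.decay p.cu p.cξ a ξ)
    (hcons : ∀ k : Fin τ, (a k).2.1 = rollout f a 0 ξ k)
    (hK : ∀ k : Fin τ, ‖(a k).2.2‖ ≤ p.RK)
    (hr0 : 0 ≤ r) (hr1 : r ≤ 1) (hU : p.pert r ≤ p.radius)
    (hξ : ‖ξ - ξ'‖ ≤ 2 * p.cγ * p.pert r) (hab : (dMax a b : ℝ) ≤ r) (hτ : p.c3 ≤ τ) :
    (∀ k ≤ τ, ‖rollout f a 0 ξ k - rollout f b 0 ξ' k‖ ≤ 3 * p.cγ * p.cβ * p.pert r) ∧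
    (∀ k : Fin τ, ‖applyCtrl (a k) (rollout f a 0 ξ k) - applyCtrl (b k) (rollout f b 0 ξ' k)‖ ≤
      p.pert r + p.RK * (3 * p.cγ * p.cβ * p.pert r)) ∧
    ‖rollout f a 0 ξ τ - rollout f b 0 ξ' τ‖ ≤ 2 * p.cγ * p.pert r := by
  set U := p.pert r with hUdef
  have hradξ : p.radius ≤ p.cξ / (4 * p.cγ) := min_le_right _ _
  have hradu : p.radius ≤ p.cu := min_le_left _ _
  have hrad0 : 0 < p.radius := lt_min hcu (by positivity)
  have hsp : 0 < p.spread := by unfold StabParams.spread; positivity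
  have hU0 : 0 ≤ U := by rw [hUdef]; unfold StabParams.pert; positivity
  have hUξ : 2 * p.cγ * U ≤ p.cξ := by
    have h4 : p.cξ / (4 * p.cγ) * (4 * p.cγ) = p.cξ := by field_simp
    have : U * (4 * p.cγ) ≤ p.cξ := h4 ▸ mul_le_mul_of_nonneg_right (hU.trans hradξ) (by positivity)
    nlinarith [mul_nonneg hcγ.le hU0]
  have hspread : 3 * p.cγ * p.cβ * U ≤ p.spread := by
    have h1 : p.cγ * U ≤ p.cγ * p.radius := by gcongr
    have h2 : 0 ≤ p.cγ * U := by positivity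
    have : 3 * (p.cγ * U) ≤ 4 * p.cγ * p.radius + p.cξ := by linarith
    unfold StabParams.spread
    nlinarith [mul_le_mul_of_nonneg_left this hcβ.le]
  have hstep : ∀ k : Fin τ, (nndist (a k).1 (b k).1 + nndist (a k).2.1 (b k).2.1 +
      nndist (a k).2.2 (b k).2.2 : ℝ) ≤ r := fun k => by
    refine le_trans ?_ hab
    have := Finset.le_sup (f := fun k => nndist (a k).1 (b k).1 + nndist (a k).2.1 (b k).2.1 +
      nndist (a k).2.2 (b k).2.2) (mem_univ k)
    exact_mod_cast this
  set δ : Fin τ → Vec du := fun s => applyCtrl (b s) (rollout f b 0 ξ' s) -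
      applyCtrl (a s) (rollout f b 0 ξ' s) with hδ
  have hδU : ∀ k : Fin τ, ‖rollout f a 0 ξ k - rollout f b 0 ξ' k‖ ≤ 3 * p.cγ * p.cβ * U →
      ‖δ k‖ ≤ U := fun k hk => by
    refine norm_applyCtrl_sub_le (hstep k) hr1 (hK k) ?_
    rw [hcons, norm_sub_rev]
    exact hk.trans hspread
  have hiss : ∀ k ≤ τ, (∀ s : Fin τ, (s : ℕ) < k → ‖δ s‖ ≤ U) →
      ‖rollout f a 0 ξ k - rollout f b 0 ξ' k‖ ≤
        p.cβ * Real.exp (-(p.L * k)) * ‖ξ - ξ'‖ + p.cγ * U := fun k hk hs => by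
    -- Stability requires every perturbation to be at most `cu`, but during the induction only those
    -- before step `k` are bounded. The later ones are replaced by zero, which does not affect the
    -- state at step `k`.
    have h1 := ha ξ ξ' (fun s => if (s : ℕ) < k then δ s else 0) (by simpa using hcξ.le)
      (by rw [norm_sub_rev]; exact hξ.trans hUξ) (fun s => by
        split_ifs with h
        · exact (hs s h).trans (hU.trans hradu)
        · simpa using hcu.le) k hk
    rw [rollout_congr f a (δ' := δ) ξ' (fun s h => by simp [h]), hδ,
      rollout_eq_rollout_perturbed, ← hδ] at h1
    refine h1.trans (add_le_add (le_of_eq ?_) (gain_sup_le hcγ hU0 k fun s h => ?_))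
    · simp [StabParams.decay]
    · simpa [h] using hs s h
  have hall : ∀ k ≤ τ, ‖rollout f a 0 ξ k - rollout f b 0 ξ' k‖ ≤ 3 * p.cγ * p.cβ * U := by
    intro k
    induction k using Nat.strong_induction_on with
    | _ k ih =>
      intro hk
      rcases subsingleton_or_one_le_of_isLocalTISS hcu hcξ ha with hs | hβ
      · rw [Subsingleton.elim (rollout f a 0 ξ k) (rollout f b 0 ξ' k), sub_self, norm_zero]
        positivity
      · refine (hiss k hk fun s hs => hδU s (ih s hs s.2.le)).trans ?_
        have hexp : Real.exp (-(p.L * k)) ≤ 1 := Real.exp_le_one_iff.2 (by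
          have : 0 ≤ p.L * k := by positivity
          linarith)
        have h1 : p.cβ * Real.exp (-(p.L * k)) * ‖ξ - ξ'‖ ≤ p.cβ * 1 * (2 * p.cγ * U) := by
          gcongr
        have h2 : 1 * (p.cγ * U) ≤ p.cβ * (p.cγ * U) := by gcongr
        linarith
  refine ⟨hall, fun k => ?_, ?_⟩
  · have hd : applyCtrl (a k) (rollout f a 0 ξ k) - applyCtrl (b k) (rollout f b 0 ξ' k) =
        (a k).2.2 (rollout f a 0 ξ k - rollout f b 0 ξ' k) - δ k := by
      simp only [hδ, applyCtrl, map_sub]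
      abel
    rw [hd]
    have h1 : ‖(a k).2.2 (rollout f a 0 ξ k - rollout f b 0 ξ' k)‖ ≤
        p.RK * (3 * p.cγ * p.cβ * U) :=
      (ContinuousLinearMap.le_opNorm _ _).trans
        (mul_le_mul (hK k) (hall k k.2.le) (norm_nonneg _) hRK)
    linarith [norm_sub_le ((a k).2.2 (rollout f a 0 ξ k - rollout f b 0 ξ' k)) (δ k),
      hδU k (hall k k.2.le)]
  · refine (hiss τ le_rfl fun s _ => hδU s (hall s s.2.le)).trans ?_
    have hlog : Real.log (2 * Real.exp 1 * p.cβ) ≤ p.L * τ := by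
      rw [mul_comm p.L]; exact (div_le_iff₀ hL).1 hτ
    have hexp : 2 * Real.exp 1 * p.cβ ≤ Real.exp (p.L * τ) :=
      (Real.log_le_iff_le_exp (by positivity)).1 hlog
    have he1 : (1 : ℝ) ≤ Real.exp 1 := Real.one_le_exp (by norm_num)
    -- This is the purpose of `c3`: the contraction factor over the whole chunk is at most one half.
    have hhalf : p.cβ * Real.exp (-(p.L * τ)) ≤ 1 / 2 := by
      rw [Real.exp_neg, ← div_eq_mul_inv, div_le_iff₀ (Real.exp_pos _)]
      nlinarith
    have := mul_le_mul hhalf hξ (norm_nonneg _) (by norm_num)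
    linarith

/-! ### Couplings of kernels -/

section Kernels

variable {X A B : Type*} [MeasurableSpace X] [MeasurableSpace A] [MeasurableSpace B]

theorem measurable_measure_sub {P Q : X → Measure A} (hP : Measurable P) (hQ : Measurable Q)
    [∀ x, IsFiniteMeasure (Q x)] (hle : ∀ x, Q x ≤ P x) : Measurable fun x => P x - Q x := by
  refine Measure.measurable_of_measurable_coe _ fun s hs => ?_
  simp_rw [fun x => Measure.sub_apply (μ := P x) (ν := Q x) hs (hle x)]
  exact ((Measure.measurable_coe hs).comp hP).sub ((Measure.measurable_coe hs).comp hQ)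

/-- A kernel of sub-couplings extends to a kernel of couplings. -/
theorem exists_coupling_kernel_ge {P : Kernel X A} {Q : Kernel X B} [IsMarkovKernel P]
    [IsMarkovKernel Q] {ξ : Kernel X (A × B)} (h1 : ∀ x, (ξ x).map Prod.fst ≤ P x)
    (h2 : ∀ x, (ξ x).map Prod.snd ≤ Q x) :
    ∃ κ : Kernel X (A × B), IsMarkovKernel κ ∧ (∀ x, (κ x).map Prod.fst = P x) ∧
      (∀ x, (κ x).map Prod.snd = Q x) ∧ ∀ x, ξ x ≤ κ x := by
  have m1 : ∀ x, (ξ x).map Prod.fst Set.univ = ξ x Set.univ := fun x => by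
    rw [Measure.map_apply measurable_fst .univ, Set.preimage_univ]
  have m2 : ∀ x, (ξ x).map Prod.snd Set.univ = ξ x Set.univ := fun x => by
    rw [Measure.map_apply measurable_snd .univ, Set.preimage_univ]
  have hξ1 : ∀ x, ξ x Set.univ ≤ 1 := fun x => by
    rw [← m1, ← measure_univ (μ := P x)]; exact h1 x _
  have : ∀ x, IsFiniteMeasure (ξ x) := fun x => ⟨(hξ1 x).trans_lt ENNReal.one_lt_top⟩
  let P' : Kernel X A := ⟨fun x => P x - (ξ x).map Prod.fst, measurable_measure_sub P.measurable
    ((Measure.measurable_map _ measurable_fst).comp ξ.measurable) h1⟩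
  let Q' : Kernel X B := ⟨fun x => Q x - (ξ x).map Prod.snd, measurable_measure_sub Q.measurable
    ((Measure.measurable_map _ measurable_snd).comp ξ.measurable) h2⟩
  have hP' : ∀ x, P' x + (ξ x).map Prod.fst = P x := fun x =>
    Measure.sub_add_cancel_of_le (h1 x)
  have hQ' : ∀ x, Q' x + (ξ x).map Prod.snd = Q x := fun x =>
    Measure.sub_add_cancel_of_le (h2 x)
  have eP : ∀ x, P' x Set.univ = 1 - ξ x Set.univ := fun x => by
    refine (ENNReal.sub_eq_of_eq_add (measure_ne_top _ _) ?_).symm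
    rw [← m1, ← Measure.add_apply, hP', measure_univ]
  have eQ : ∀ x, Q' x Set.univ = 1 - ξ x Set.univ := fun x => by
    refine (ENNReal.sub_eq_of_eq_add (measure_ne_top _ _) ?_).symm
    rw [← m2, ← Measure.add_apply, hQ', measure_univ]
  have : IsFiniteKernel P' := ⟨1, ENNReal.one_lt_top, fun x => (eP x).trans_le tsub_le_self⟩
  have : IsFiniteKernel Q' := ⟨1, ENNReal.one_lt_top, fun x => (eQ x).trans_le tsub_le_self⟩
  -- The missing parts of both marginals have the same mass `1 - ξ x univ`, and their normalized
  -- product fills the gap. When that mass is `0`, the factor is `∞`, but both residual measures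
  -- vanish.
  let c : X → ℝ≥0∞ := fun x => (1 - ξ x Set.univ)⁻¹
  have hc : Measurable c := (measurable_const.sub (ξ.measurable_coe .univ)).inv
  let κ : Kernel X (A × B) := ⟨fun x => ξ x + c x • (P' x).prod (Q' x), by
    refine Measure.measurable_of_measurable_coe _ fun s hs => ?_
    have := (P' ×ₖ Q').measurable_coe hs
    simp only [Kernel.prod_apply] at this
    simp only [Measure.add_apply, Measure.smul_apply, smul_eq_mul]
    exact (ξ.measurable_coe hs).add (hc.mul this)⟩
  have hκ : ∀ x, κ x = ξ x + c x • (P' x).prod (Q' x) := fun x => rfl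
  have hmass : ∀ x, (1 - ξ x Set.univ) = 0 ∨ c x * (1 - ξ x Set.univ) = 1 := fun x => by
    by_cases h : 1 - ξ x Set.univ = 0
    · exact Or.inl h
    · exact Or.inr (ENNReal.inv_mul_cancel h (ne_top_of_le_ne_top ENNReal.one_ne_top tsub_le_self))
  have hfst : ∀ x, (κ x).map Prod.fst = P x := fun x => by
    rw [hκ, Measure.map_add _ _ measurable_fst, Measure.map_smul, Measure.map_fst_prod,
      smul_smul, eQ, ← hP' x, add_comm]
    congr 1
    rcases hmass x with h | h
    · rw [Measure.measure_univ_eq_zero.1 ((eP x).trans h), smul_zero]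
    · rw [h, one_smul]
  have hsnd : ∀ x, (κ x).map Prod.snd = Q x := fun x => by
    rw [hκ, Measure.map_add _ _ measurable_snd, Measure.map_smul, Measure.map_snd_prod,
      smul_smul, eP, ← hQ' x, add_comm]
    congr 1
    rcases hmass x with h | h
    · rw [Measure.measure_univ_eq_zero.1 ((eQ x).trans h), smul_zero]
    · rw [h, one_smul]
  refine ⟨κ, ⟨fun x => ⟨?_⟩⟩, hfst, hsnd, fun x => ?_⟩
  · rw [← Set.preimage_univ (f := Prod.fst), ← Measure.map_apply measurable_fst .univ, hfst,
      measure_univ]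
  · rw [hκ]; exact Measure.le_add_right le_rfl

theorem measureReal_sub_le_tvDist {P Q : Measure A} [IsProbabilityMeasure P]
    [IsProbabilityMeasure Q] {S : Set A} (hS : MeasurableSet S) :
    P.real S - Q.real S ≤ tvDist P Q := by
  refine (le_abs_self _).trans (le_ciSup (f := fun S : {S : Set A // MeasurableSet S} =>
    |P.real S.1 - Q.real S.1|) ⟨1, ?_⟩ ⟨S, hS⟩)
  rintro _ ⟨T, rfl⟩
  have h1 : P.real T.1 ≤ 1 := measureReal_le_one
  have h2 : Q.real T.1 ≤ 1 := measureReal_le_one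
  have h3 : 0 ≤ P.real T.1 := measureReal_nonneg
  have h4 : 0 ≤ Q.real T.1 := measureReal_nonneg
  exact abs_le.2 ⟨by linarith, by linarith⟩

theorem measure_le_add_tvDist {P Q : Measure A} [IsProbabilityMeasure P]
    [IsProbabilityMeasure Q] {S : Set A} (hS : MeasurableSet S) :
    P S ≤ Q S + ENNReal.ofReal (tvDist P Q) := by
  have h := measureReal_sub_le_tvDist (P := P) (Q := Q) hS
  rw [← ofReal_measureReal (μ := P), ← ofReal_measureReal (μ := Q)]
  calc ENNReal.ofReal (P.real S) ≤ ENNReal.ofReal (Q.real S + tvDist P Q) :=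
        ENNReal.ofReal_le_ofReal (by linarith)
    _ ≤ _ := ENNReal.ofReal_add_le

/-- The part of `Q` that lies below `Q'` has mass at least one minus their total variation. -/
theorem one_le_lintegral_min_rnDeriv_add_tvDist {Q Q' : Measure A} [IsProbabilityMeasure Q]
    [IsProbabilityMeasure Q'] :
    1 ≤ ∫⁻ b, min 1 (Q'.rnDeriv Q b) ∂Q + ENNReal.ofReal (tvDist Q Q') := by
  obtain ⟨N, hN, hN1, hN2⟩ := Q'.mutuallySingular_singularPart Q
  have hw : Measurable (Q'.rnDeriv Q) := Measure.measurable_rnDeriv _ _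
  -- The set where the density is below one, cut to a `Q`-full set that the singular part of `Q'`
  -- does not charge. The integral of the minimum is then `Q' S + Q Sᶜ`, which is `1 - (Q S - Q'
  -- S)`.
  set S : Set A := {b | Q'.rnDeriv Q b < 1} ∩ N with hSdef
  have hS : MeasurableSet S := (measurableSet_lt hw measurable_const).inter hN
  have hQ'S : Q' S = ∫⁻ b in S, Q'.rnDeriv Q b ∂Q := by
    conv_lhs => rw [Measure.haveLebesgueDecomposition_add Q' Q]
    rw [Measure.add_apply, measure_mono_null Set.inter_subset_right hN1, zero_add,
      withDensity_apply _ hS]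
  have hSc : ∀ᵐ b ∂Q, b ∈ Sᶜ → min 1 (Q'.rnDeriv Q b) = 1 := by
    have : ∀ᵐ b ∂Q, b ∈ N := by
      rw [ae_iff]; exact hN2
    filter_upwards [this] with b hb hbS
    refine min_eq_left (not_lt.1 fun h => hbS ⟨h, hb⟩)
  have h1 : ∫⁻ b in S, min 1 (Q'.rnDeriv Q b) ∂Q = Q' S := by
    rw [hQ'S]
    exact setLIntegral_congr_fun hS fun b hb => min_eq_right hb.1.le
  have h2 : ∫⁻ b in Sᶜ, min 1 (Q'.rnDeriv Q b) ∂Q = Q Sᶜ := by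
    rw [setLIntegral_congr_fun_ae hS.compl hSc]
    simp
  rw [← lintegral_add_compl _ hS, h1, h2, ← measure_univ (μ := Q), ← measure_add_measure_compl hS]
  calc Q S + Q Sᶜ ≤ (Q' S + ENNReal.ofReal (tvDist Q Q')) + Q Sᶜ := by
        gcongr; exact measure_le_add_tvDist hS
    _ = _ := by ring

/-- Moving the second marginal of a coupling kernel costs at most the total variation. -/
theorem exists_coupling_kernel_tvDist [MeasurableSpace.CountablyGenerated B] {P : Kernel X A}
    {Q Q' : Kernel X B} [IsMarkovKernel P] [IsMarkovKernel Q] [IsMarkovKernel Q']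
    {K : Kernel X (A × B)} [IsMarkovKernel K] (h1 : ∀ x, (K x).map Prod.fst = P x)
    (h2 : ∀ x, (K x).map Prod.snd = Q x) :
    ∃ κ : Kernel X (A × B), IsMarkovKernel κ ∧ (∀ x, (κ x).map Prod.fst = P x) ∧
      (∀ x, (κ x).map Prod.snd = Q' x) ∧ ∀ x, ∀ G, MeasurableSet G →
        κ x G ≤ K x G + ENNReal.ofReal (tvDist (Q x) (Q' x)) := by
  -- Thinning `K` by this weight of the second coordinate leaves marginals below `P` and `Q'`, and
  -- removes at most the total variation in mass.
  let w : X → A × B → ℝ≥0∞ := fun x z => min 1 (Kernel.rnDeriv Q' Q x z.2)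
  have hw : Measurable (Function.uncurry w) :=
    measurable_const.min ((Kernel.measurable_rnDeriv Q' Q).comp
      (measurable_fst.prodMk measurable_snd.snd))
  have hwx : ∀ x, Measurable (w x) := fun x => hw.comp measurable_prodMk_left
  have hξ : ∀ x, (K.withDensity w) x = (K x).withDensity (w x) := fun x =>
    Kernel.withDensity_apply _ hw x
  have hle : ∀ x, (K.withDensity w) x ≤ K x := fun x => by
    rw [hξ]
    exact (withDensity_mono (ae_of_all _ fun z => min_le_left _ _)).trans
      (withDensity_one (μ := K x)).le
  have hb : ∀ x, Measurable fun b => min 1 (Kernel.rnDeriv Q' Q x b) := fun x =>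
    measurable_const.min (Kernel.measurable_rnDeriv_right Q' Q x)
  obtain ⟨κ, hκ, hκ1, hκ2, hκ3⟩ := exists_coupling_kernel_ge (P := P) (Q := Q')
    (ξ := K.withDensity w)
    (fun x => (Measure.map_mono (hle x) measurable_fst).trans (h1 x).le)
    (fun x => by
      refine Measure.le_iff.2 fun s hs => ?_
      rw [Measure.map_apply measurable_snd hs, hξ, withDensity_apply _ (measurable_snd hs)]
      have : ∫⁻ z in Prod.snd ⁻¹' s, w x z ∂(K x) =
          ∫⁻ b in s, min 1 (Kernel.rnDeriv Q' Q x b) ∂(Q x) := by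
        rw [← h2, setLIntegral_map hs (hb x) measurable_snd]
      rw [this]
      calc _ ≤ ∫⁻ b in s, Kernel.rnDeriv Q' Q x b ∂(Q x) :=
            lintegral_mono fun b => min_le_right _ _
        _ ≤ Q' x s := Kernel.setLIntegral_rnDeriv_le hs)
  refine ⟨κ, hκ, hκ1, hκ2, fun x G hG => ?_⟩
  have hmass : 1 ≤ K.withDensity w x Set.univ + ENNReal.ofReal (tvDist (Q x) (Q' x)) := by
    rw [hξ, withDensity_apply _ .univ, setLIntegral_univ]
    have : ∫⁻ z, w x z ∂(K x) = ∫⁻ b, min 1 ((Q' x).rnDeriv (Q x) b) ∂(Q x) := by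
      have e : ∫⁻ z, w x z ∂(K x) = ∫⁻ b, min 1 (Kernel.rnDeriv Q' Q x b) ∂(Q x) := by
        rw [← h2, lintegral_map (hb x) measurable_snd]
      rw [e]
      refine lintegral_congr_ae ?_
      filter_upwards [Kernel.rnDeriv_eq_rnDeriv_measure (κ := Q') (η := Q) (a := x)] with b hb
      rw [hb]
    rw [this]
    exact one_le_lintegral_min_rnDeriv_add_tvDist
  have hκc : κ x G + κ x Gᶜ = 1 := by rw [measure_add_measure_compl hG, measure_univ]
  -- The completion may put its extra mass anywhere, so `G` is estimated through its complement: `κ`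
  -- dominates the thinned measure on `Gᶜ`, and both kernels have total mass one.
  have hbound : κ x G + κ x Gᶜ ≤
      (K x G + ENNReal.ofReal (tvDist (Q x) (Q' x))) + κ x Gᶜ := by
    rw [hκc]
    refine hmass.trans ?_
    rw [← measure_add_measure_compl hG, add_right_comm]
    exact add_le_add (add_le_add (hle x G) le_rfl) (hκ3 x Gᶜ)
  exact (ENNReal.add_le_add_iff_right (measure_ne_top _ _)).1 hbound

end Kernels

/-! ### Measurable selection of nearly optimal couplings -/

/-- Finitely supported plans on `ℕ × ℕ` with rational entries. -/
noncomputable def ratPlan (t : ℕ × (ℕ × ℕ →₀ ℕ)) (z : ℕ × ℕ) : ℝ≥0∞ :=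
  ENNReal.ofReal ((t.2 z : ℝ) / (t.1 + 1))

/-- `m` is a plan supported on `R` whose marginals are at most `p` and `q`. -/
def IsSubplan (R : Set (ℕ × ℕ)) (p q : ℕ → ℝ≥0∞) (m : ℕ × ℕ → ℝ≥0∞) : Prop :=
  (∀ i, ∑' j, m (i, j) ≤ p i) ∧ (∀ j, ∑' i, m (i, j) ≤ q j) ∧ ∀ z, z ∉ R → m z = 0

theorem IsSubplan.mono {R : Set (ℕ × ℕ)} {p q : ℕ → ℝ≥0∞} {m m' : ℕ × ℕ → ℝ≥0∞}
    (h : IsSubplan R p q m) (hm : ∀ z, m' z ≤ m z) : IsSubplan R p q m' :=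
  ⟨fun i => (ENNReal.tsum_le_tsum fun j => hm (i, j)).trans (h.1 i),
    fun j => (ENNReal.tsum_le_tsum fun i => hm (i, j)).trans (h.2.1 j),
    fun z hz => le_antisymm ((hm z).trans (h.2.2 z hz).le) zero_le⟩

/-- A finite set of entries carries all but `η / 2` of the mass; rounding these down to multiples of
`1 / (N + 1)` with `N` large costs at most another `η / 2`. -/
theorem exists_ratPlan_le {m : ℕ × ℕ → ℝ≥0∞} (hm : ∑' z, m z ≠ ∞) {η : ℝ≥0∞} (hη : η ≠ 0) :
    ∃ t, (∀ z, ratPlan t z ≤ m z) ∧ ∑' z, m z ≤ ∑' z, ratPlan t z + η := by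
  classical
  have hη2 : η / 2 ≠ 0 := by simpa using hη
  obtain ⟨S, hS⟩ : ∃ S : Finset (ℕ × ℕ), ∑' z, m z ≤ ∑ z ∈ S, m z + η / 2 := by
    by_cases h0 : ∑' z, m z = 0
    · exact ⟨∅, by simp [h0]⟩
    · have := ENNReal.sub_lt_self hm h0 hη2
      conv_rhs at this => rw [ENNReal.tsum_eq_iSup_sum]
      obtain ⟨S, hS⟩ := lt_iSup_iff.1 this
      exact ⟨S, tsub_le_iff_right.1 hS.le⟩
  have hfin : ∀ z, m z ≠ ∞ := fun z => ne_top_of_le_ne_top hm (ENNReal.le_tsum z)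
  obtain ⟨N, hN⟩ := ENNReal.exists_inv_nat_lt (a := η / 2 / (S.card + 1))
    (ENNReal.div_ne_zero.2 ⟨hη2, by finiteness⟩)
  have hN' : ENNReal.ofReal (1 / ((N : ℝ) + 1)) ≤ η / 2 / (S.card + 1) := by
    refine le_trans ?_ hN.le
    rw [one_div, ENNReal.ofReal_inv_of_pos (by positivity)]
    gcongr
    rw [ENNReal.ofReal_add (by positivity) zero_le_one]
    simp
  have hNpos : (0 : ℝ) < (N : ℝ) + 1 := by positivity
  let t : ℕ × (ℕ × ℕ →₀ ℕ) := (N, Finsupp.onFinset S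
    (fun z => if z ∈ S then ⌊((N : ℝ) + 1) * (m z).toReal⌋₊ else 0)
    fun z hz => by by_contra h; simp [h] at hz)
  have ht : ∀ z, ratPlan t z =
      ENNReal.ofReal (((if z ∈ S then ⌊((N : ℝ) + 1) * (m z).toReal⌋₊ else 0 : ℕ) : ℝ) / (N + 1)) :=
    fun z => rfl
  refine ⟨t, fun z => ?_, ?_⟩
  · rw [ht]
    split_ifs with h
    · refine (ENNReal.ofReal_le_ofReal ?_).trans (ENNReal.ofReal_toReal (hfin z)).le
      rw [div_le_iff₀ hNpos, mul_comm]
      exact Nat.floor_le (by positivity)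
    · simp
  · have h1 : ∀ z ∈ S, m z ≤ ratPlan t z + η / 2 / (S.card + 1) := fun z hz => by
      rw [ht, if_pos hz]
      refine le_trans ?_ (add_le_add le_rfl hN')
      rw [← ENNReal.ofReal_add (by positivity) (by positivity), ← add_div]
      refine (ENNReal.ofReal_toReal (hfin z)).symm.le.trans (ENNReal.ofReal_le_ofReal ?_)
      rw [le_div_iff₀ hNpos, mul_comm]
      exact (Nat.lt_floor_add_one _).le
    have h2 : (S.card : ℝ≥0∞) * (η / 2 / (S.card + 1)) ≤ η / 2 := by
      calc _ ≤ ((S.card : ℝ≥0∞) + 1) * (η / 2 / (S.card + 1)) := by gcongr; exact le_self_add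
        _ ≤ _ := ENNReal.mul_div_le
    calc _ ≤ ∑ z ∈ S, m z + η / 2 := hS
      _ ≤ ∑ z ∈ S, (ratPlan t z + η / 2 / (S.card + 1)) + η / 2 := by gcongr with z hz; exact h1 z hz
      _ ≤ (∑ z ∈ S, ratPlan t z + η / 2) + η / 2 := by
          rw [Finset.sum_add_distrib, Finset.sum_const, nsmul_eq_mul]
          gcongr
      _ = ∑ z ∈ S, ratPlan t z + η := by rw [add_assoc, ENNReal.add_halves]
      _ ≤ _ := by gcongr; exact ENNReal.sum_le_tsum S

/-- Feasibility of a fixed rational plan is a measurable condition on `x`, and there are countably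
many such plans, so taking the first one within `η / 2` of the best rational mass is measurable.
Marginal inequalities are used instead of equalities because rounding down preserves them. -/
theorem exists_measurable_subplan {X : Type*} [MeasurableSpace X] {p q : X → ℕ → ℝ≥0∞}
    (hp : ∀ i, Measurable fun x => p x i) (hq : ∀ i, Measurable fun x => q x i)
    (hp1 : ∀ x, ∑' i, p x i ≤ 1) (R : Set (ℕ × ℕ)) {η : ℝ≥0∞} (hη : η ≠ 0) :
    ∃ W : X → ℕ × ℕ → ℝ≥0∞, (∀ z, Measurable fun x => W x z) ∧
      (∀ x, IsSubplan R (p x) (q x) (W x)) ∧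
      ∀ x m, IsSubplan R (p x) (q x) m → ∑' z, m z ≤ ∑' z, W x z + η := by
  classical
  have hη2 : η / 2 ≠ 0 := by simpa using hη
  have hmass : ∀ x m, IsSubplan R (p x) (q x) m → ∑' z, m z ≤ 1 := fun x m hm => by
    rw [ENNReal.tsum_prod']
    exact (ENNReal.tsum_le_tsum hm.1).trans (hp1 x)
  have hfeas : ∀ t, MeasurableSet {x | IsSubplan R (p x) (q x) (ratPlan t)} := fun t => by
    refine MeasurableSet.inter ?_ (MeasurableSet.inter ?_ (MeasurableSet.const _))
    · exact (measurableSet_setOfPred.2 <| Measurable.forall fun i =>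
        measurableSet_setOfPred.1 (measurableSet_le measurable_const (hp i)))
    · exact (measurableSet_setOfPred.2 <| Measurable.forall fun i =>
        measurableSet_setOfPred.1 (measurableSet_le measurable_const (hq i)))
  obtain ⟨e, he⟩ := exists_surjective_nat (ℕ × (ℕ × ℕ →₀ ℕ))
  let M : X → ℝ≥0∞ := fun x =>
    ⨆ t, if IsSubplan R (p x) (q x) (ratPlan t) then ∑' z, ratPlan t z else 0
  have hM : Measurable M := Measurable.iSup fun t =>
    Measurable.ite (hfeas t) measurable_const measurable_const
  have hM1 : ∀ x, M x ≤ 1 := fun x => iSup_le fun t => by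
    split_ifs with h
    · exact hmass x _ h
    · exact zero_le_one
  have hle : ∀ x t, IsSubplan R (p x) (q x) (ratPlan t) → ∑' z, ratPlan t z ≤ M x :=
    fun x t h => by
      have := le_iSup (fun t => if IsSubplan R (p x) (q x) (ratPlan t)
        then ∑' z, ratPlan t z else 0) t
      simpa only [h, if_true] using this
  have hex : ∀ x, ∃ n, IsSubplan R (p x) (q x) (ratPlan (e n)) ∧
      M x ≤ ∑' z, ratPlan (e n) z + η / 2 := fun x => by
    -- The zero plan is always feasible and serves when the supremum is `0`, where no strictly
    -- smaller value could be used to find a plan.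
    have h0 : IsSubplan R (p x) (q x) (ratPlan (0, 0)) := by
      refine ⟨fun i => ?_, fun i => ?_, fun z _ => ?_⟩ <;> simp [ratPlan]
    by_cases hz : M x = 0
    · obtain ⟨n, hn⟩ := he (0, 0)
      exact ⟨n, by rwa [hn], by simp [hz]⟩
    · have := ENNReal.sub_lt_self (ne_top_of_le_ne_top ENNReal.one_ne_top (hM1 x)) hz hη2
      obtain ⟨t, ht⟩ := lt_iSup_iff.1 this
      split_ifs at ht with h
      · obtain ⟨n, rfl⟩ := he t
        exact ⟨n, h, tsub_le_iff_right.1 ht.le⟩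
      · exact absurd ht not_lt_zero
  refine ⟨fun x => ratPlan (e (Nat.find (hex x))), fun z => ?_, fun x => (Nat.find_spec (hex x)).1,
    fun x m hm => ?_⟩
  · exact Measurable.find (f := fun n _ => ratPlan (e n) z)
      (p := fun n x => IsSubplan R (p x) (q x) (ratPlan (e n)) ∧
        M x ≤ ∑' z, ratPlan (e n) z + η / 2) (fun n => measurable_const)
      (fun n => (hfeas (e n)).inter (measurableSet_le hM measurable_const)) hex
  · obtain ⟨t, ht, ht'⟩ := exists_ratPlan_le
      (ne_top_of_le_ne_top ENNReal.one_ne_top (hmass x m hm)) hη2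
    calc _ ≤ ∑' z, ratPlan t z + η / 2 := ht'
      _ ≤ M x + η / 2 := by gcongr; exact hle x t (hm.mono ht)
      _ ≤ (∑' z, ratPlan (e (Nat.find (hex x))) z + η / 2) + η / 2 := by
          gcongr; exact (Nat.find_spec (hex x)).2
      _ = _ := by rw [add_assoc, ENNReal.add_halves]

theorem lintegral_comp_nat {A : Type*} [MeasurableSpace A] {c : A → ℕ} (hc : Measurable c)
    (P : Measure A) (F : ℕ → ℝ≥0∞) : ∫⁻ a, F (c a) ∂P = ∑' i, F i * P (c ⁻¹' {i}) := by
  rw [← lintegral_map (f := F) (measurable_of_countable _) hc, lintegral_countable']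
  simp_rw [Measure.map_apply hc (measurableSet_singleton _)]

/-- The quotient is the density of the plan with respect to the product of `p` and `q`, and the sum
is its integral over the second variable. The case distinctions treat zero and infinite masses. -/
theorem IsSubplan.tsum_div_mul_le_one {R : Set (ℕ × ℕ)} {p q : ℕ → ℝ≥0∞} {m : ℕ × ℕ → ℝ≥0∞}
    (h : IsSubplan R p q m) (i : ℕ) : ∑' j, m (i, j) / (p i * q j) * q j ≤ 1 := by
  calc _ ≤ ∑' j, m (i, j) / p i := ENNReal.tsum_le_tsum fun j => by
        by_cases hq0 : q j = 0
        · simp [hq0]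
        by_cases hqt : q j = ∞
        · by_cases hp0 : p i = 0
          · have : m (i, j) = 0 := le_antisymm (hp0 ▸ (ENNReal.le_tsum j).trans (h.1 i)) zero_le
            simp [this]
          · simp [hqt, hp0, ENNReal.mul_top]
        · rw [div_eq_mul_inv, div_eq_mul_inv, ENNReal.mul_inv (Or.inr hqt) (Or.inr hq0), mul_assoc,
            mul_assoc, ENNReal.inv_mul_cancel hq0 hqt, mul_one]
    _ = (∑' j, m (i, j)) / p i := by simp_rw [div_eq_mul_inv, ENNReal.tsum_mul_right]
    _ ≤ p i / p i := by gcongr; exact h.1 i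
    _ ≤ 1 := ENNReal.div_self_le_one

theorem IsSubplan.swap {R : Set (ℕ × ℕ)} {p q : ℕ → ℝ≥0∞} {m : ℕ × ℕ → ℝ≥0∞}
    (h : IsSubplan R p q m) : IsSubplan (Prod.swap ⁻¹' R) q p (m ∘ Prod.swap) :=
  ⟨h.2.1, h.1, fun z hz => h.2.2 z.swap hz⟩

theorem IsSubplan.div_mul_mul {R : Set (ℕ × ℕ)} {p q : ℕ → ℝ≥0∞} {m : ℕ × ℕ → ℝ≥0∞}
    (h : IsSubplan R p q m) {i j : ℕ} (hp : p i ≠ ∞) (hq : q j ≠ ∞) :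
    m (i, j) / (p i * q j) * q j * p i = m (i, j) := by
  by_cases h0 : p i * q j = 0
  · have : m (i, j) = 0 := by
      rcases mul_eq_zero.1 h0 with h0 | h0
      · exact le_antisymm (h0 ▸ (ENNReal.le_tsum j).trans (h.1 i)) zero_le
      · exact le_antisymm (h0 ▸ (ENNReal.le_tsum i).trans (h.2.1 j)) zero_le
    simp [this]
  · rw [mul_assoc, mul_comm (q j), ENNReal.div_mul_cancel h0 (ENNReal.mul_ne_top hp hq)]

/-- For a countable partition, there is a measurable choice of couplings that nearly maximize the
mass of a union `R` of products of cells. -/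
theorem exists_coupling_kernel_cells {X A : Type*} [MeasurableSpace X] [MeasurableSpace A]
    (P Q : Kernel X A) [IsMarkovKernel P] [IsMarkovKernel Q] {c : A → ℕ} (hc : Measurable c)
    (R : Set (ℕ × ℕ)) {η : ℝ≥0∞} (hη : η ≠ 0) :
    ∃ κ : Kernel X (A × A), IsMarkovKernel κ ∧ (∀ x, (κ x).map Prod.fst = P x) ∧
      (∀ x, (κ x).map Prod.snd = Q x) ∧ ∀ x μ, IsCoupling μ (P x) (Q x) →
        μ {z | (c z.1, c z.2) ∈ R} ≤ κ x {z | (c z.1, c z.2) ∈ R} + η := by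
  have hcell : ∀ i, MeasurableSet (c ⁻¹' {i}) := fun i => hc (measurableSet_singleton i)
  have hcc : Measurable fun z : A × A => (c z.1, c z.2) :=
    (hc.comp measurable_fst).prodMk (hc.comp measurable_snd)
  have hsum : ∀ (P : Measure A), ∑' i, P (c ⁻¹' {i}) = P Set.univ := fun P => by
    simpa using (lintegral_comp_nat hc P 1).symm
  have hsum2 : ∀ (μ : Measure (A × A)) i, ∑' j, μ ((fun z => (c z.1, c z.2)) ⁻¹' {(i, j)}) =
      μ.map Prod.fst (c ⁻¹' {i}) := fun μ i => by
    rw [Measure.map_apply measurable_fst (hcell i), ← measure_iUnion]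
    · congr 1; ext z; simp
    · intro j j' hj
      refine Set.disjoint_left.2 fun z h1 h2 => hj ?_
      simp at h1 h2
      rw [← h1.2, ← h2.2]
    · exact fun j => hcc (measurableSet_singleton _)
  have hsum3 : ∀ (μ : Measure (A × A)) j, ∑' i, μ ((fun z => (c z.1, c z.2)) ⁻¹' {(i, j)}) =
      μ.map Prod.snd (c ⁻¹' {j}) := fun μ j => by
    rw [Measure.map_apply measurable_snd (hcell j), ← measure_iUnion]
    · congr 1; ext z; simp
    · intro i i' hi
      refine Set.disjoint_left.2 fun z h1 h2 => hi ?_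
      simp at h1 h2
      rw [← h1.1, ← h2.1]
    · exact fun j => hcc (measurableSet_singleton _)
  let p : X → ℕ → ℝ≥0∞ := fun x i => P x (c ⁻¹' {i})
  let q : X → ℕ → ℝ≥0∞ := fun x i => Q x (c ⁻¹' {i})
  have hp : ∀ i, Measurable fun x => p x i := fun i => P.measurable_coe (hcell i)
  have hq : ∀ i, Measurable fun x => q x i := fun i => Q.measurable_coe (hcell i)
  obtain ⟨W, hW, hWs, hWopt⟩ := exists_measurable_subplan hp hq
    (fun x => ((hsum (P x)).trans measure_univ).le) R hη
  -- The plan between cells is lifted to `A × A` by spreading each entry over its product of cells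
  -- proportionally to `P × Q`.
  let V : X → ℕ × ℕ → ℝ≥0∞ := fun x z => W x z / (p x z.1 * q x z.2)
  have hV : ∀ z, Measurable fun x => V x z := fun z => (hW z).div ((hp z.1).mul (hq z.2))
  let φ : X → A × A → ℝ≥0∞ := fun x z => V x (c z.1, c z.2)
  have hV' : Measurable (Function.uncurry V) := measurable_from_prod_countable_left hV
  have hφ : Measurable (Function.uncurry φ) :=
    hV'.comp (measurable_fst.prodMk (hcc.comp measurable_snd))
  have hφx : ∀ x, Measurable (φ x) := fun x => hφ.comp measurable_prodMk_left
  let ξ : Kernel X (A × A) := (P ×ₖ Q).withDensity φ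
  have hξ : ∀ x, ξ x = ((P x).prod (Q x)).withDensity (φ x) := fun x => by
    rw [← Kernel.prod_apply]; exact Kernel.withDensity_apply _ hφ x
  have hin : ∀ x a, ∫⁻ b, φ x (a, b) ∂(Q x) = ∑' j, V x (c a, j) * q x j := fun x a =>
    lintegral_comp_nat hc (Q x) fun j => V x (c a, j)
  have hin' : ∀ x b, ∫⁻ a, φ x (a, b) ∂(P x) = ∑' i, V x (i, c b) * p x i := fun x b =>
    lintegral_comp_nat hc (P x) fun i => V x (i, c b)
  obtain ⟨κ, hκ, hκ1, hκ2, hκ3⟩ := exists_coupling_kernel_ge (P := P) (Q := Q) (ξ := ξ)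
    (fun x => Measure.le_iff.2 fun s hs => by
      rw [Measure.map_apply measurable_fst hs, hξ, withDensity_apply _ (measurable_fst hs),
        ← lintegral_indicator (measurable_fst hs),
        lintegral_prod _ ((hφx x).indicator (measurable_fst hs)).aemeasurable]
      calc _ ≤ ∫⁻ a, s.indicator 1 a ∂(P x) := lintegral_mono fun a => by
            by_cases ha : a ∈ s
            · simp only [Set.indicator, Set.mem_preimage, ha, if_true, hin, Pi.one_apply]
              exact (hWs x).tsum_div_mul_le_one (c a)
            · simp [Set.indicator, ha]
        _ = P x s := lintegral_indicator_one hs)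
    (fun x => Measure.le_iff.2 fun s hs => by
      rw [Measure.map_apply measurable_snd hs, hξ, withDensity_apply _ (measurable_snd hs),
        ← lintegral_indicator (measurable_snd hs),
        lintegral_prod_symm _ ((hφx x).indicator (measurable_snd hs)).aemeasurable]
      calc _ ≤ ∫⁻ a, s.indicator 1 a ∂(Q x) := lintegral_mono fun b => by
            by_cases hb : b ∈ s
            · simp only [Set.indicator, Set.mem_preimage, hb, if_true, hin', Pi.one_apply]
              have := (hWs x).swap.tsum_div_mul_le_one (c b)
              simpa only [V, Function.comp_apply, Prod.swap_prod_mk, mul_comm (q x (c b))] using this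
            · simp [Set.indicator, hb]
        _ = Q x s := lintegral_indicator_one hs)
  refine ⟨κ, hκ, hκ1, hκ2, fun x μ hμ => ?_⟩
  have hRm : MeasurableSet {z : A × A | (c z.1, c z.2) ∈ R} := hcc (Set.to_countable R).measurableSet
  have hξR : ξ x {z | (c z.1, c z.2) ∈ R} = ∑' z, W x z := by
    rw [hξ, withDensity_apply _ hRm, ← lintegral_indicator hRm]
    have : ({z : A × A | (c z.1, c z.2) ∈ R}.indicator (φ x)) = φ x := by
      refine Set.indicator_eq_self.2 fun z hz => ?_
      by_contra h
      exact hz (by simp only [φ, V, (hWs x).2.2 _ h, ENNReal.zero_div])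
    rw [this, lintegral_prod _ (hφx x).aemeasurable]
    simp_rw [hin]
    rw [lintegral_comp_nat hc (P x) fun i => ∑' j, V x (i, j) * q x j, ENNReal.tsum_prod']
    refine tsum_congr fun i => ?_
    rw [← ENNReal.tsum_mul_right]
    exact tsum_congr fun j => (hWs x).div_mul_mul (measure_ne_top _ _) (measure_ne_top _ _)
  classical
  -- Any competing coupling, read on cells and restricted to `R`, is a subplan, so the selected plan
  -- nearly beats it.
  let m : ℕ × ℕ → ℝ≥0∞ := fun z =>
    if z ∈ R then μ ((fun z => (c z.1, c z.2)) ⁻¹' {z}) else 0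
  have hm : ∀ z, m z ≤ μ ((fun z => (c z.1, c z.2)) ⁻¹' {z}) := fun z => by
    simp only [m]; split_ifs
    · exact le_rfl
    · exact zero_le
  have hmR : ∑' z, m z = μ {z | (c z.1, c z.2) ∈ R} := by
    have := Measure.tsum_indicator_apply_singleton (μ.map fun z => (c z.1, c z.2)) R
      (Set.to_countable R).measurableSet
    rw [Measure.map_apply hcc (Set.to_countable R).measurableSet] at this
    rw [Set.preimage] at this
    rw [← this]
    refine tsum_congr fun z => ?_
    rw [Set.indicator, Measure.map_apply hcc (measurableSet_singleton z)]
  rw [← hmR]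
  refine (hWopt x m ⟨fun i => ?_, fun j => ?_, fun z hz => by simp [m, hz]⟩).trans ?_
  · exact (ENNReal.tsum_le_tsum fun j => hm (i, j)).trans ((hsum2 μ i).trans_le (by rw [hμ.1]))
  · exact (ENNReal.tsum_le_tsum fun i => hm (i, j)).trans ((hsum3 μ j).trans_le (by rw [hμ.2]))
  · rw [← hξR]
    exact add_le_add (hκ3 x _) le_rfl

/-! ### The distance between composite actions -/

instance {dx du : ℕ} : StandardBorelSpace (PrimCtrl dx du) := inferInstance

instance {dx du τ : ℕ} : OpensMeasurableSpace (CompAct dx du τ × CompAct dx du τ) :=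
  Prod.opensMeasurableSpace

theorem continuous_dMax {dx du τ : ℕ} :
    Continuous fun z : CompAct dx du τ × CompAct dx du τ => dMax z.1 z.2 := by
  unfold dMax
  refine Continuous.finset_sup_apply fun k _ => ?_
  fun_prop

theorem measurable_dMax {dx du τ : ℕ} :
    Measurable fun z : CompAct dx du τ × CompAct dx du τ => dMax z.1 z.2 :=
  continuous_dMax.measurable

theorem measurableSet_lt_dMax {dx du τ : ℕ} (r : ℝ) :
    MeasurableSet {z : CompAct dx du τ × CompAct dx du τ | r < (dMax z.1 z.2 : ℝ)} :=
  measurableSet_lt measurable_const measurable_dMax.coe_nnreal_real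

theorem dMax_triangle {dx du τ : ℕ} (a b c : CompAct dx du τ) :
    dMax a c ≤ dMax a b + dMax b c := by
  refine Finset.sup_le fun k hk => ?_
  refine le_trans ?_ (add_le_add (Finset.le_sup (f := fun k => nndist (a k).1 (b k).1 +
    nndist (a k).2.1 (b k).2.1 + nndist (a k).2.2 (b k).2.2) hk)
    (Finset.le_sup (f := fun k => nndist (b k).1 (c k).1 +
    nndist (b k).2.1 (c k).2.1 + nndist (b k).2.2 (c k).2.2) hk))
  have h1 := nndist_triangle (a k).1 (b k).1 (c k).1
  have h2 := nndist_triangle (a k).2.1 (b k).2.1 (c k).2.1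
  have h3 := nndist_triangle (a k).2.2 (b k).2.2 (c k).2.2
  calc _ ≤ _ := add_le_add (add_le_add h1 h2) h3
    _ = _ := by ring

theorem nndist_fst_le {A B : Type*} [PseudoMetricSpace A] [PseudoMetricSpace B] (x y : A × B) :
    nndist x.1 y.1 ≤ nndist x y :=
  NNReal.coe_le_coe.1 (by rw [coe_nndist, coe_nndist, Prod.dist_eq]; exact le_max_left _ _)

theorem nndist_snd_le {A B : Type*} [PseudoMetricSpace A] [PseudoMetricSpace B] (x y : A × B) :
    nndist x.2 y.2 ≤ nndist x y :=
  NNReal.coe_le_coe.1 (by rw [coe_nndist, coe_nndist, Prod.dist_eq]; exact le_max_right _ _)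

/-- The product metric takes the maximum of the three components where `dMax` takes their sum. This
makes cells of small metric diameter small for `dMax`. -/
theorem dMax_le_nndist {dx du τ : ℕ} (a b : CompAct dx du τ) : dMax a b ≤ 3 * nndist a b := by
  refine Finset.sup_le fun k hk => ?_
  have h0 : nndist (a k) (b k) ≤ nndist a b := nndist_le_pi_nndist a b k
  have h2 := (nndist_snd_le (a k) (b k)).trans h0
  calc _ ≤ nndist a b + nndist a b + nndist a b := by
        gcongr
        · exact (nndist_fst_le _ _).trans h0
        · exact (nndist_fst_le _ _).trans h2
        · exact (nndist_snd_le _ _).trans h2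
    _ = _ := by ring

theorem eq_of_dMax_eq_zero {dx du τ : ℕ} {a b : CompAct dx du τ} (h : dMax a b = 0) : a = b := by
  funext k
  have := Finset.le_sup (f := fun k => nndist (a k).1 (b k).1 +
    nndist (a k).2.1 (b k).2.1 + nndist (a k).2.2 (b k).2.2) (mem_univ k)
  have h0 : nndist (a k).1 (b k).1 + nndist (a k).2.1 (b k).2.1 +
    nndist (a k).2.2 (b k).2.2 = 0 := le_antisymm (this.trans h.le) zero_le
  simp only [add_eq_zero, nndist_eq_zero] at h0
  exact Prod.ext h0.1.1 (Prod.ext h0.1.2 h0.2)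

/-- A separable metric space has a countable measurable partition into cells of small diameter. -/
theorem exists_measurable_cells {A : Type*} [PseudoMetricSpace A] [SecondCountableTopology A]
    [MeasurableSpace A] [OpensMeasurableSpace A] [Nonempty A] {δ : ℝ} (hδ : 0 < δ) :
    ∃ c : A → ℕ, Measurable c ∧ ∀ a b, c a = c b → dist a b < δ := by
  classical
  have hex : ∀ a : A, ∃ n, dist a (TopologicalSpace.denseSeq A n) < δ / 2 := fun a => by
    obtain ⟨n, hn⟩ :=
      (TopologicalSpace.denseRange_denseSeq A).exists_dist_lt a (half_pos hδ)
    exact ⟨n, hn⟩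
  refine ⟨fun a => Nat.find (hex a), measurable_find hex fun n =>
    measurableSet_lt (measurable_id.dist measurable_const) measurable_const, fun a b hab => ?_⟩
  have ha := Nat.find_spec (hex a)
  have hb := Nat.find_spec (hex b)
  simp only at hab
  rw [← hab] at hb
  linarith [dist_triangle_right a b (TopologicalSpace.denseSeq A (Nat.find (hex a)))]

theorem IsCoupling.isProbabilityMeasure {A B : Type*} [MeasurableSpace A] [MeasurableSpace B]
    {μ : Measure (A × B)} {P : Measure A} {Q : Measure B} [IsProbabilityMeasure P]
    (h : IsCoupling μ P Q) : IsProbabilityMeasure μ := ⟨by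
  rw [← Set.preimage_univ (f := Prod.fst), ← Measure.map_apply measurable_fst .univ, h.1,
    measure_univ]⟩

/-- The coupling inequality: `dMax` separates points, so off the event `0 < dMax` both coordinates
lie in the same sets. -/
theorem ofReal_tvDist_le_otProb_zero {dx du τ : ℕ} {P Q : Measure (CompAct dx du τ)}
    [IsProbabilityMeasure P] [IsProbabilityMeasure Q] :
    ENNReal.ofReal (tvDist P Q) ≤ otProb 0 P Q := by
  refine le_iInf₂ fun μ hμ => ?_
  have := hμ.isProbabilityMeasure
  refine ENNReal.ofReal_le_of_le_toReal ?_
  have : Nonempty {S : Set (CompAct dx du τ) // MeasurableSet S} := ⟨⟨∅, .empty⟩⟩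
  refine ciSup_le fun S => ?_
  obtain ⟨S, hS⟩ := S
  have hP : P.real S = μ.real (Prod.fst ⁻¹' S) := by
    rw [← hμ.1, map_measureReal_apply measurable_fst hS]
  have hQ : Q.real S = μ.real (Prod.snd ⁻¹' S) := by
    rw [← hμ.2, map_measureReal_apply measurable_snd hS]
  have hne : ∀ z : CompAct dx du τ × CompAct dx du τ, z.1 ≠ z.2 → 0 < (dMax z.1 z.2 : ℝ) :=
    fun z hz => NNReal.coe_pos.2 (pos_iff_ne_zero.2 fun h => hz (eq_of_dMax_eq_zero h))
  have key : ∀ s t : Set (CompAct dx du τ × CompAct dx du τ),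
      (∀ z, z ∈ s → z ∉ t → z.1 ≠ z.2) →
      μ.real s ≤ μ.real t + μ.real {z | 0 < (dMax z.1 z.2 : ℝ)} := fun s t h =>
    (measureReal_mono (fun z hz => by
      by_cases ht : z ∈ t
      · exact Or.inl ht
      · exact Or.inr (hne z (h z hz ht)))).trans (measureReal_union_le _ _)
  change |P.real S - Q.real S| ≤ μ.real {z | 0 < (dMax z.1 z.2 : ℝ)}
  rw [hP, hQ, abs_le]
  constructor
  · linarith [key (Prod.snd ⁻¹' S) (Prod.fst ⁻¹' S) fun z h1 h2 h => h2 (by simpa [h] using h1)]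
  · linarith [key (Prod.fst ⁻¹' S) (Prod.snd ⁻¹' S) fun z h1 h2 h => h2 (by simpa [h] using h1)]

/-- A measurable choice of couplings that are optimal for `otProb`, up to `η` and up to an
enlargement of the radius, which is not needed when the radius is `0`. -/
theorem exists_coupling_kernel_otProb {X : Type*} [MeasurableSpace X] {dx du τ : ℕ}
    (P Q : Kernel X (CompAct dx du τ)) [IsMarkovKernel P] [IsMarkovKernel Q] {r r' : ℝ}
    (hr : r < r' ∨ (r = 0 ∧ r' = 0)) {η : ℝ≥0∞} (hη : η ≠ 0) :
    ∃ κ : Kernel X (CompAct dx du τ × CompAct dx du τ), IsMarkovKernel κ ∧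
      (∀ x, (κ x).map Prod.fst = P x) ∧ (∀ x, (κ x).map Prod.snd = Q x) ∧
      ∀ x, κ x {z | r' < (dMax z.1 z.2 : ℝ)} ≤ otProb r (P x) (Q x) + η := by
  rcases hr with hr | ⟨rfl, rfl⟩
  -- With `dMax ≤ 3 dist`, points of one cell are within `(r' - r) / 2`; moving both coordinates
  -- inside their cells costs at most `r' - r`.
  · obtain ⟨c, hc, hcd⟩ := exists_measurable_cells (A := CompAct dx du τ) (δ := (r' - r) / 6)
      (by linarith)
    have hcd' : ∀ a b, c a = c b → (dMax a b : ℝ) ≤ (r' - r) / 2 := fun a b h => by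
      have h1 := dMax_le_nndist a b
      have h2 := hcd a b h
      have h3 : (dMax a b : ℝ) ≤ 3 * dist a b := by exact_mod_cast h1
      linarith
    -- The pairs of cells that meet `{dMax ≤ r}`. Their union lies between `{dMax ≤ r}` and `{dMax ≤
    -- r'}`, so maximizing its mass nearly minimizes the probability of failure.
    let R : Set (ℕ × ℕ) := (fun z : CompAct dx du τ × CompAct dx du τ => (c z.1, c z.2)) ''
      {z | (dMax z.1 z.2 : ℝ) ≤ r}
    obtain ⟨κ, hκ, h1, h2, h3⟩ := exists_coupling_kernel_cells P Q hc R hη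
    refine ⟨κ, hκ, h1, h2, fun x => tsub_le_iff_right.1 (le_iInf₂ fun μ hμ =>
      tsub_le_iff_right.2 ?_)⟩
    have := hμ.isProbabilityMeasure
    have hR : {z : CompAct dx du τ × CompAct dx du τ | (c z.1, c z.2) ∈ R} ⊆
        {z | r' < (dMax z.1 z.2 : ℝ)}ᶜ := by
      rintro ⟨a, b⟩ ⟨⟨a', b'⟩, hab, he⟩
      simp only [Prod.mk.injEq] at he
      simp only [Set.mem_compl_iff, Set.mem_ofPred_eq, not_lt] at hab ⊢
      have t1 : (dMax a b : ℝ) ≤ dMax a a' + dMax a' b := by exact_mod_cast dMax_triangle a a' b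
      have t2 : (dMax a' b : ℝ) ≤ dMax a' b' + dMax b' b := by
        exact_mod_cast dMax_triangle a' b' b
      linarith [hcd' a a' he.1.symm, hcd' b' b he.2]
    have hR' : {z : CompAct dx du τ × CompAct dx du τ | r < (dMax z.1 z.2 : ℝ)}ᶜ ⊆
        {z | (c z.1, c z.2) ∈ R} := fun z hz => Set.mem_image_of_mem _ (by simpa using hz)
    have hc1 : κ x {z | (c z.1, c z.2) ∈ R} ≤ κ x {z | r' < (dMax z.1 z.2 : ℝ)}ᶜ :=
      measure_mono hR
    refine (ENNReal.add_le_add_iff_right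
      (measure_ne_top (κ x) {z | r' < (dMax z.1 z.2 : ℝ)}ᶜ)).1 ?_
    calc _ = μ {z | r < (dMax z.1 z.2 : ℝ)} + μ {z | r < (dMax z.1 z.2 : ℝ)}ᶜ := by
          rw [measure_add_measure_compl (measurableSet_lt_dMax _),
            measure_add_measure_compl (measurableSet_lt_dMax _), measure_univ, measure_univ]
      _ ≤ μ {z | r < (dMax z.1 z.2 : ℝ)} + (κ x {z | r' < (dMax z.1 z.2 : ℝ)}ᶜ + η) :=
          add_le_add le_rfl ((measure_mono hR').trans ((h3 x μ hμ).trans (add_le_add hc1 le_rfl)))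
      _ = _ := by ring
  -- At radius `0` the diagonal coupling of `P` with itself never fails; moving its second marginal
  -- to `Q` costs the total variation, which `otProb 0` dominates.
  · have hdiag : Measurable fun a : CompAct dx du τ => (a, a) := measurable_id.prodMk measurable_id
    have : IsMarkovKernel (P.map fun a => (a, a)) := Kernel.IsMarkovKernel.map _ hdiag
    obtain ⟨κ, hκ, h1, h2, h3⟩ := exists_coupling_kernel_tvDist (P := P) (Q := P) (Q' := Q)
      (K := P.map fun a => (a, a))
      (fun x => by
        rw [Kernel.map_apply _ hdiag, Measure.map_map measurable_fst hdiag]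
        exact Measure.map_id)
      (fun x => by
        rw [Kernel.map_apply _ hdiag, Measure.map_map measurable_snd hdiag]
        exact Measure.map_id)
    refine ⟨κ, hκ, h1, h2, fun x => (h3 x _ (measurableSet_lt_dMax 0)).trans ?_⟩
    rw [Kernel.map_apply' _ hdiag _ (measurableSet_lt_dMax 0)]
    have : (fun a : CompAct dx du τ => (a, a)) ⁻¹' {z | (0 : ℝ) < (dMax z.1 z.2 : ℝ)} = ∅ := by
      ext a; simp [dMax]
    rw [this, measure_empty, zero_add]
    exact ofReal_tvDist_le_otProb_zero.trans le_self_add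

/-- Markov's inequality, applied to each coupling before taking the infimum. -/
theorem otProb_le_wass1 {dx du τ : ℕ} {r : ℝ} (hr : 0 < r) (P Q : Measure (CompAct dx du τ)) :
    otProb r P Q ≤ ENNReal.ofReal r⁻¹ * wass1 P Q := by
  have hr0 : ENNReal.ofReal r ≠ 0 := by simpa using hr
  rw [ENNReal.ofReal_inv_of_pos hr, mul_comm, ← div_eq_mul_inv,
    ENNReal.le_div_iff_mul_le (Or.inl hr0) (Or.inl ENNReal.ofReal_ne_top), mul_comm]
  refine le_iInf₂ fun μ hμ => ?_
  calc _ ≤ ENNReal.ofReal r * μ {z | r < (dMax z.1 z.2 : ℝ)} := by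
        gcongr; exact iInf₂_le μ hμ
    _ ≤ ENNReal.ofReal r * μ {z | ENNReal.ofReal r ≤ (dMax z.1 z.2 : ℝ≥0∞)} := by
        gcongr with z
        intro hz
        rw [← ENNReal.ofReal_coe_nnreal]
        exact ENNReal.ofReal_le_ofReal hz.le
    _ ≤ _ := mul_meas_ge_le_lintegral measurable_dMax.coe_nnreal_ennreal _

/-! ### Gluing -/

theorem map_compProd_comap {A B C : Type*} [MeasurableSpace A] [MeasurableSpace B]
    [MeasurableSpace C] (μ : Measure A) [SFinite μ] {g : A → B} (hg : Measurable g)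
    (κ : Kernel B C) [IsSFiniteKernel κ] :
    (μ ⊗ₘ κ.comap g hg).map (fun z => (g z.1, z.2)) = μ.map g ⊗ₘ κ := by
  have hm : Measurable fun z : A × C => (g z.1, z.2) :=
    (hg.comp measurable_fst).prodMk measurable_snd
  ext s hs
  rw [Measure.map_apply hm hs, Measure.compProd_apply (hm hs), Measure.compProd_apply hs,
    lintegral_map (Kernel.measurable_kernel_prodMk_left hs) hg]
  rfl

/-- Draw `(y, v)` from `M`, then `z` from the conditional law under `D` given `g z = y`,
independently of `v`. Standard Borel structure on `Z` supplies that conditional law. -/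
theorem exists_glue {Z Y V : Type*} [MeasurableSpace Z] [StandardBorelSpace Z] [Nonempty Z]
    [MeasurableSpace Y] [MeasurableEq Y] [MeasurableSpace V] {D : Measure Z}
    [IsProbabilityMeasure D] {g : Z → Y} (hg : Measurable g) {M : Measure (Y × V)}
    [IsProbabilityMeasure M] (hM : M.map Prod.fst = D.map g) :
    ∃ μ : Measure (Z × V), μ.map Prod.fst = D ∧ μ.map (fun z => (g z.1, z.2)) = M := by
  have hgi : Measurable fun z => (g z, z) := hg.prodMk measurable_id
  set J : Measure (Y × Z) := D.map fun z => (g z, z) with hJ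
  have : IsProbabilityMeasure J := Measure.isProbabilityMeasure_map hgi.aemeasurable
  have hJfst : J.fst = M.map Prod.fst := by
    rw [hM, Measure.fst, hJ, Measure.map_map measurable_fst hgi]; rfl
  let N : Measure ((Y × V) × Z) := M ⊗ₘ J.condKernel.comap Prod.fst measurable_fst
  have hN : N.map (fun z => (z.1.1, z.2)) = J := by
    rw [map_compProd_comap, ← hJfst, Measure.disintegrate]
  -- The pair `(y, z)` has law `J`, which is carried by the graph of `g`; hence the redrawn `z`
  -- really has the prescribed image.
  have hae : ∀ᵐ z ∂N, g z.2 = z.1.1 := by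
    have h1 : ∀ᵐ y ∂J, g y.2 = y.1 := by
      have hs : MeasurableSet {y : Y × Z | g y.2 = y.1} :=
        measurableSet_eq_fun (hg.comp measurable_snd) measurable_fst
      rw [hJ, ae_map_iff hgi.aemeasurable hs]
      exact ae_of_all _ fun z => rfl
    rw [← hN] at h1
    exact ae_of_ae_map (measurable_fst.fst.prodMk measurable_snd).aemeasurable h1
  have hsw : Measurable fun z : (Y × V) × Z => (z.2, z.1.2) :=
    measurable_snd.prodMk measurable_fst.snd
  refine ⟨N.map fun z => (z.2, z.1.2), ?_, ?_⟩
  · rw [Measure.map_map measurable_fst hsw]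
    have : (Prod.fst ∘ fun z : (Y × V) × Z => (z.2, z.1.2)) =
        Prod.snd ∘ fun z => (z.1.1, z.2) := rfl
    rw [this, ← Measure.map_map measurable_snd (measurable_fst.fst.prodMk measurable_snd), hN, hJ,
      Measure.map_map measurable_snd hgi]
    exact Measure.map_id
  · have hgi' : Measurable fun z : Z × V => (g z.1, z.2) :=
      (hg.comp measurable_fst).prodMk measurable_snd
    rw [Measure.map_map hgi' hsw]
    have : N.map ((fun z : Z × V => (g z.1, z.2)) ∘ fun z : (Y × V) × Z => (z.2, z.1.2)) =
        N.map Prod.fst := by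
      refine Measure.map_congr ?_
      filter_upwards [hae] with z hz
      simp [hz]
    rw [this, ← Measure.fst, Measure.fst_compProd]

/-- One step of the construction: the first component is redrawn from `D` given its observation
and the action that was drawn for it, the action of the second component is drawn jointly. -/
theorem exists_step {Z W O A : Type*} [MeasurableSpace Z] [StandardBorelSpace Z] [Nonempty Z]
    [MeasurableSpace W] [MeasurableSpace O] [MeasurableSpace A] [MeasurableEq (O × A)]
    {D : Measure Z} [IsProbabilityMeasure D] {ν : Measure (Z × W)} [IsProbabilityMeasure ν]
    (hν : ν.map Prod.fst = D) {o : Z → O} (ho : Measurable o) {act : Z → A} (hact : Measurable act)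
    {o' : W → O} (ho' : Measurable o') {π π' : Kernel O A} [IsMarkovKernel π] [IsMarkovKernel π']
    (hπ : D.map (fun z => (o z, act z)) = D.map o ⊗ₘ π) {K : Kernel (O × O) (A × A)}
    [IsMarkovKernel K] (hK1 : ∀ x, (K x).map Prod.fst = π x.1)
    (hK2 : ∀ x, (K x).map Prod.snd = π' x.2) :
    ∃ μ : Measure (Z × (W × A)), μ.map Prod.fst = D ∧
      μ.map Prod.snd = ν.map Prod.snd ⊗ₘ π'.comap o' ho' ∧
      ∀ S : Set ((O × W) × (A × A)), MeasurableSet S →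
        μ {y | ((o y.1, y.2.1), (act y.1, y.2.2)) ∈ S} =
          ∫⁻ z, K (o z.1, o' z.2) {q | ((o z.1, z.2), q) ∈ S} ∂ν := by
  have hoo : Measurable fun z : Z × W => (o z.1, o' z.2) :=
    (ho.comp measurable_fst).prodMk (ho'.comp measurable_snd)
  have hg : Measurable fun z => (o z, act z) := ho.prodMk hact
  let N : Measure ((Z × W) × (A × A)) := ν ⊗ₘ K.comap _ hoo
  -- Of the expert only the observation and the new action are kept; the old trajectory need not be
  -- compatible with that action and is discarded.
  let e : (Z × W) × (A × A) → (O × A) × (W × A) := fun y =>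
    ((o y.1.1, y.2.1), (y.1.2, y.2.2))
  have he : Measurable e := ((ho.comp measurable_fst.fst).prodMk measurable_snd.fst).prodMk
    (measurable_fst.snd.prodMk measurable_snd.snd)
  have : IsProbabilityMeasure (N.map e) := Measure.isProbabilityMeasure_map he.aemeasurable
  have hN1 : N.map (fun y => (y.1, y.2.1)) = ν ⊗ₘ π.comap (fun z => o z.1)
      (ho.comp measurable_fst) := by
    have : (K.comap _ hoo).map Prod.fst = π.comap (fun z : Z × W => o z.1)
        (ho.comp measurable_fst) := by
      ext1 x
      rw [Kernel.map_apply _ measurable_fst, Kernel.comap_apply, Kernel.comap_apply, hK1]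
    rw [← this, Measure.compProd_map measurable_fst]
    rfl
  have hN2 : N.map (fun y => (y.1, y.2.2)) = ν ⊗ₘ (π'.comap o' ho').comap Prod.snd
      measurable_snd := by
    have : (K.comap _ hoo).map Prod.snd = (π'.comap o' ho').comap (Prod.snd : Z × W → W)
        measurable_snd := by
      ext1 x
      rw [Kernel.map_apply _ measurable_snd, Kernel.comap_apply, Kernel.comap_apply,
        Kernel.comap_apply, hK2]
    rw [← this, Measure.compProd_map measurable_snd]
    rfl
  -- The retained pair has the law it has under `D`, because `π` disintegrates that law. This is the
  -- compatibility needed for gluing.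
  have hM : (N.map e).map Prod.fst = D.map fun z => (o z, act z) := by
    have h1 : (Prod.fst ∘ e) = (fun z : (Z × W) × A => (o z.1.1, z.2)) ∘
        fun y => (y.1, y.2.1) := rfl
    have h2 : Measurable fun z : (Z × W) × A => (o z.1.1, z.2) :=
      (ho.comp measurable_fst.fst).prodMk measurable_snd
    have h3 := map_compProd_comap ν (g := fun z : Z × W => o z.1) (ho.comp measurable_fst) π
    rw [Measure.map_map measurable_fst he, h1, ← Measure.map_map h2
      (measurable_fst.prodMk measurable_snd.fst), hN1, h3, hπ]
    have : ν.map (fun z => o z.1) = D.map o := by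
      rw [← hν, Measure.map_map ho measurable_fst]; rfl
    rw [← this]
  obtain ⟨μ, hμ1, hμ2⟩ := exists_glue hg hM
  have hgi : Measurable fun z : Z × (W × A) => ((o z.1, act z.1), z.2) :=
    (hg.comp measurable_fst).prodMk measurable_snd
  refine ⟨μ, hμ1, ?_, fun S hS => ?_⟩
  · have h1 : (Prod.snd : Z × (W × A) → W × A) =
        Prod.snd ∘ fun z => ((o z.1, act z.1), z.2) := rfl
    have h2 : Prod.snd ∘ e = (fun z : (Z × W) × A => (z.1.2, z.2)) ∘ fun y => (y.1, y.2.2) := rfl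
    rw [h1, ← Measure.map_map measurable_snd hgi, hμ2, Measure.map_map measurable_snd he, h2,
      ← Measure.map_map (measurable_fst.snd.prodMk measurable_snd)
      (measurable_fst.prodMk measurable_snd.snd), hN2]
    exact map_compProd_comap ν measurable_snd (π'.comap o' ho')
  · let s : (O × A) × (W × A) → (O × W) × (A × A) := fun y =>
      ((y.1.1, y.2.1), (y.1.2, y.2.2))
    have hs : Measurable s := (measurable_fst.fst.prodMk measurable_snd.fst).prodMk
      (measurable_fst.snd.prodMk measurable_snd.snd)
    have h1 : μ {y | ((o y.1, y.2.1), (act y.1, y.2.2)) ∈ S} = N.map e (s ⁻¹' S) := by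
      rw [← hμ2, Measure.map_apply hgi (hs hS)]; rfl
    rw [h1, Measure.map_apply he (hs hS), Measure.compProd_apply (he (hs hS))]
    rfl

/-! ### Executing a chunk -/

theorem measurable_applyCtrl {dx du : ℕ} :
    Measurable fun z : PrimCtrl dx du × Vec dx => applyCtrl z.1 z.2 := by
  have h : Continuous fun z : PrimCtrl dx du × Vec dx => applyCtrl z.1 z.2 := by
    unfold applyCtrl
    fun_prop
  have : OpensMeasurableSpace (PrimCtrl dx du × Vec dx) := Prod.opensMeasurableSpace
  exact h.measurable

theorem measurable_rollout {dx du τ : ℕ} {f : Vec dx → Vec du → Vec dx}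
    (hf : Measurable (Function.uncurry f)) (k : ℕ) :
    Measurable fun z : CompAct dx du τ × Vec dx => rollout f z.1 0 z.2 k := by
  induction k with
  | zero => exact measurable_snd
  | succ k ih =>
    by_cases hk : k < τ
    · simp only [rollout, hk, dite_true, Pi.zero_apply, add_zero]
      exact hf.comp (ih.prodMk (measurable_applyCtrl.comp
        (((measurable_pi_apply _).comp measurable_fst).prodMk ih)))
    · simpa only [rollout, hk, dite_false] using ih

theorem measurable_execChunk {dx du n τ : ℕ} {f : Vec dx → Vec du → Vec dx}
    (hf : Measurable (Function.uncurry f)) (h : ℕ) :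
    Measurable fun z : Traj dx du n × CompAct dx du τ => execChunk f h z.1 z.2 := by
  have hroll : ∀ k, Measurable fun z : Traj dx du n × CompAct dx du τ =>
      rollout f z.2 0 (stateAt z.1 (h * τ)) k := fun k =>
    (measurable_rollout hf k).comp
      (measurable_snd.prodMk ((measurable_stateAt _).comp measurable_fst))
  unfold execChunk
  refine Measurable.prodMk (measurable_pi_lambda _ fun t => ?_) (measurable_pi_lambda _ fun t => ?_)
  · split_ifs
    · exact hroll _
    · exact (measurable_pi_apply t).comp measurable_fst.fst
  · split_ifs with hk
    · have ha : Measurable fun z : Traj dx du n × CompAct dx du τ => z.2 ⟨(t : ℕ) - h * τ, hk.2⟩ :=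
        (measurable_pi_apply _).comp measurable_snd
      exact measurable_applyCtrl.comp (ha.prodMk (hroll _))
    · exact (measurable_pi_apply t).comp measurable_fst.snd

theorem chunk_end_le {H τ h : ℕ} (hh : h < H) : h * τ + τ ≤ H * τ := by
  rw [← Nat.succ_mul]; exact Nat.mul_le_mul_right _ hh

theorem stateAt_execChunk {dx du H τ : ℕ} (f : Vec dx → Vec du → Vec dx) {h : ℕ} (hh : h < H)
    (ρ : Traj dx du (H * τ)) (a : CompAct dx du τ) {k : ℕ} (hk : k ≤ τ) :
    stateAt (execChunk f h ρ a) (h * τ + k) = rollout f a 0 (stateAt ρ (h * τ)) k := by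
  have := chunk_end_le (τ := τ) hh
  have hlt : h * τ + k < H * τ + 1 := by omega
  rcases Nat.eq_zero_or_pos k with rfl | hk0
  · simp [stateAt, execChunk, rollout]
  · rw [stateAt, dif_pos hlt, execChunk]
    simp only
    rw [if_pos ⟨by omega, by omega⟩, Nat.add_sub_cancel_left]

theorem inputAt_execChunk {dx du H τ : ℕ} (f : Vec dx → Vec du → Vec dx) {h : ℕ} (hh : h < H)
    (ρ : Traj dx du (H * τ)) (a : CompAct dx du τ) (k : Fin τ) :
    inputAt (execChunk f h ρ a) (h * τ + k) =
      applyCtrl (a k) (rollout f a 0 (stateAt ρ (h * τ)) k) := by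
  have := chunk_end_le (τ := τ) hh
  have hlt : h * τ + k < H * τ := by omega
  rw [inputAt, dif_pos hlt, execChunk]
  simp only [Nat.add_sub_cancel_left]
  rw [dif_pos ⟨by omega, k.2⟩]

theorem stateAt_execChunk_of_le {dx du n τ : ℕ} (f : Vec dx → Vec du → Vec dx) {h t : ℕ}
    (ht : t ≤ h * τ) (ρ : Traj dx du n) (a : CompAct dx du τ) :
    stateAt (execChunk f h ρ a) t = stateAt ρ t := by
  unfold stateAt
  split_ifs with hlt
  · rw [execChunk]
    simp only
    rw [if_neg (by omega)]
  · rfl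

theorem inputAt_execChunk_of_lt {dx du n τ : ℕ} (f : Vec dx → Vec du → Vec dx) {h t : ℕ}
    (ht : t < h * τ) (ρ : Traj dx du n) (a : CompAct dx du τ) :
    inputAt (execChunk f h ρ a) t = inputAt ρ t := by
  unfold inputAt
  split_ifs with hlt
  · rw [execChunk]
    simp only
    rw [dif_neg (by omega)]
  · rfl

/-- On a consistent trajectory the synthesized controllers reproduce states and inputs. -/
theorem rollout_eq_stateAt {dx du H τ : ℕ} {f : Vec dx → Vec du → Vec dx}
    {ρ : Traj dx du (H * τ)} (hdyn : ∀ t : Fin (H * τ), ρ.1 t.succ = f (ρ.1 t.castSucc) (ρ.2 t))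
    {κ : Fin (H * τ) → PrimCtrl dx du}
    (hcons : ∀ t, (κ t).1 = ρ.2 t ∧ (κ t).2.1 = ρ.1 t.castSucc) (h : Fin H) {k : ℕ} (hk : k ≤ τ) :
    rollout f (chunkAct h κ) 0 (stateAt ρ (h * τ)) k = stateAt ρ (h * τ + k) := by
  induction k with
  | zero => rfl
  | succ k ih =>
    have hk' : k < τ := hk
    have hend := chunk_end_le (τ := τ) h.2
    set t : Fin (H * τ) := chunkIdx h ⟨k, hk'⟩ with ht
    have htv : (t : ℕ) = h * τ + k := rfl
    have h0 : stateAt ρ (h * τ + k) = ρ.1 t.castSucc := by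
      rw [stateAt, dif_pos (by omega)]; rfl
    have h1 : stateAt ρ (h * τ + (k + 1)) = ρ.1 t.succ := by
      rw [stateAt, dif_pos (by omega)]; rfl
    rw [rollout, dif_pos hk', ih hk'.le, h0, h1, hdyn]
    simp [chunkAct, applyCtrl, ← ht, hcons]

theorem applyCtrl_stateAt {dx du H τ : ℕ}
    {ρ : Traj dx du (H * τ)} {κ : Fin (H * τ) → PrimCtrl dx du}
    (hcons : ∀ t, (κ t).1 = ρ.2 t ∧ (κ t).2.1 = ρ.1 t.castSucc) (h : Fin H) (k : Fin τ) :
    (chunkAct h κ k).2.1 = stateAt ρ (h * τ + k) ∧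
      applyCtrl (chunkAct h κ k) (stateAt ρ (h * τ + k)) = inputAt ρ (h * τ + k) := by
  have hend := chunk_end_le (τ := τ) h.2
  have hk := k.2
  have h0 : stateAt ρ (h * τ + k) = ρ.1 (chunkIdx h k).castSucc := by
    rw [stateAt, dif_pos (by omega)]; rfl
  have h1 : inputAt ρ (h * τ + k) = ρ.2 (chunkIdx h k) := by
    rw [inputAt, dif_pos (by omega)]; rfl
  rw [h0, h1]
  simp [chunkAct, applyCtrl, hcons]

/-! ### Closeness of observations and of chunks -/

/-- Two observation chunks are close, with their current states at distance at most `d`. -/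
def ObsClose {dx du n : ℕ} (ε : ℝ≥0) (d : ℝ) (o o' : Traj dx du n) : Prop :=
  dTraj o o' ≤ ε ∧ ‖o.1 (Fin.last n) - o'.1 (Fin.last n)‖ ≤ d

/-- Two trajectories are close during chunk `h`, with their final states at distance at
most `d`. -/
def ChunkClose {dx du n : ℕ} (ε : ℝ≥0) (d : ℝ) (τ h : ℕ) (ρ ρ' : Traj dx du n) : Prop :=
  (∀ k < τ, ‖stateAt ρ (h * τ + k + 1) - stateAt ρ' (h * τ + k + 1)‖ ≤ ε) ∧
  (∀ k < τ, ‖inputAt ρ (h * τ + k) - inputAt ρ' (h * τ + k)‖ ≤ ε) ∧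
  ‖stateAt ρ (h * τ + τ) - stateAt ρ' (h * τ + τ)‖ ≤ d

theorem measurableSet_obsClose {dx du n : ℕ} (ε : ℝ≥0) (d : ℝ) :
    MeasurableSet {z : Traj dx du n × Traj dx du n | ObsClose ε d z.1 z.2} := by
  have h : Continuous fun z : Traj dx du n × Traj dx du n => dTraj z.1 z.2 := by
    unfold dTraj
    refine Continuous.max ?_ ?_
    · exact Continuous.finset_sup_apply fun k _ => by fun_prop
    · exact Continuous.finset_sup_apply fun k _ => by fun_prop
  have h' : Continuous fun z : Traj dx du n × Traj dx du n =>
      ‖z.1.1 (Fin.last n) - z.2.1 (Fin.last n)‖ := by fun_prop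
  have : OpensMeasurableSpace (Traj dx du n × Traj dx du n) := Prod.opensMeasurableSpace
  exact (measurableSet_le h.measurable measurable_const).inter
    (measurableSet_le h'.measurable measurable_const)

theorem obsChunk_last {dx du n τ τobs : ℕ} (hτobs : 1 ≤ τobs) (h : ℕ) (ρ : Traj dx du n) :
    (obsChunk τ τobs h ρ).1 (Fin.last _) = stateAt ρ (h * τ) := by
  simp only [obsChunk, Fin.val_last]
  rw [if_pos (by omega)]
  congr 1
  omega

/-- Since `τobs ≤ τ`, the next observation window lies inside the chunk just played. Its earliest
state has time at least `h * τ + 1`, so closeness of the state at time `h * τ` is not needed. -/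
theorem ChunkClose.obsClose {dx du n τ τobs : ℕ} (hτobs : 1 ≤ τobs) (hτ : τobs ≤ τ)
    {ε : ℝ≥0} {d : ℝ} {h : ℕ} {ρ ρ' : Traj dx du n} (hc : ChunkClose ε d τ h ρ ρ') :
    ObsClose ε d (obsChunk τ τobs (h + 1) ρ) (obsChunk τ τobs (h + 1) ρ') := by
  refine ⟨max_le (Finset.sup_le fun j _ => ?_) (Finset.sup_le fun j _ => ?_), ?_⟩
  · have hj := j.2
    have he : τobs ≤ (h + 1) * τ + j + 1 := by rw [Nat.succ_mul]; omega
    have he' : (h + 1) * τ + j + 1 - τobs = h * τ + (τ + j - τobs) + 1 := by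
      rw [Nat.succ_mul]; omega
    simp only [obsChunk]
    rw [if_pos he, if_pos he, he', ← NNReal.coe_le_coe, coe_nndist, dist_eq_norm]
    exact hc.1 _ (by omega)
  · have hj := j.2
    have he : τobs ≤ (h + 1) * τ + j + 1 := by rw [Nat.succ_mul]; omega
    have he' : (h + 1) * τ + j + 1 - τobs = h * τ + (τ + j + 1 - τobs) := by
      rw [Nat.succ_mul]; omega
    simp only [obsChunk]
    rw [if_pos he, if_pos he, he', ← NNReal.coe_le_coe, coe_nndist, dist_eq_norm]
    exact hc.2.1 _ (by omega)
  · rw [obsChunk_last hτobs, obsChunk_last hτobs, Nat.succ_mul]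
    exact hc.2.2

/-- At time `0` the window holds the initial state and zero padding only, so the two observations
coincide. -/
theorem obsClose_initTraj {dx du n τ τobs : ℕ} (hτobs : 1 ≤ τobs) {ε : ℝ≥0} {d : ℝ}
    (hd : 0 ≤ d) (ρ : Traj dx du n) :
    ObsClose ε d (obsChunk τ τobs 0 ρ) (obsChunk τ τobs 0 (initTraj n (ρ.1 0))) := by
  have hs : stateAt ρ 0 = stateAt (initTraj (du := du) n (ρ.1 0)) 0 := by
    simp [stateAt, initTraj]
  have he : obsChunk τ τobs 0 ρ = obsChunk τ τobs 0 (initTraj n (ρ.1 0)) := by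
    refine Prod.ext (funext fun j => ?_) (funext fun j => ?_)
    · have hj := j.2
      simp only [obsChunk]
      split_ifs with h
      · have : 0 * τ + (j : ℕ) + 1 - τobs = 0 := by omega
        rw [this, hs]
      · rfl
    · have hj := j.2
      simp only [obsChunk]
      rw [if_neg (by omega), if_neg (by omega)]
  rw [he]
  exact ⟨by simp [dTraj], by simpa using hd⟩

namespace StabParams

/-- The radius for composite actions below which chunks stay `ε`-close. -/
noncomputable def actRadius (p : StabParams) (ε : ℝ) : ℝ :=
  ε / ((1 + 4 * p.cγ * p.cβ * (1 + p.RK)) * (1 + p.spread + p.RK))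

end StabParams

/-- One chunk of the expert and of an imitator whose composite actions are close. -/
theorem chunkClose_execChunk {dx du H τ τobs : ℕ} (hτobs : 1 ≤ τobs)
    {f : Vec dx → Vec du → Vec dx} {p : StabParams}
    (hcu : 0 < p.cu) (hcξ : 0 < p.cξ) (hcγ : 0 < p.cγ) (hcβ : 0 < p.cβ) (hL : 0 < p.L)
    (hRK : 0 ≤ p.RK) {ε : ℝ≥0} (hε1 : ε < 1) (hεr : ε ≤ p.radius) (hτc : p.c3 ≤ τ)
    {ρ : Traj dx du (H * τ)} (hdyn : ∀ t : Fin (H * τ), ρ.1 t.succ = f (ρ.1 t.castSucc) (ρ.2 t))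
    {κ : Fin (H * τ) → PrimCtrl dx du}
    (hcons : ∀ t, (κ t).1 = ρ.2 t ∧ (κ t).2.1 = ρ.1 t.castSucc)
    (hstable : ∀ h : Fin H,
      IsLocalTISS f p.gain p.decay p.cu p.cξ (chunkAct h κ) (stateAt ρ (h * τ)))
    (hK : ∀ t, ‖(κ t).2.2‖ ≤ p.RK) (h : Fin H) {ρ' : Traj dx du (H * τ)} {b : CompAct dx du τ}
    (hobs : ObsClose ε (2 * p.cγ * p.pert (p.actRadius ε))
      (obsChunk τ τobs h ρ) (obsChunk τ τobs h ρ'))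
    (hb : (dMax (chunkAct h κ) b : ℝ) ≤ p.actRadius ε) :
    ChunkClose ε (2 * p.cγ * p.pert (p.actRadius ε)) τ h ρ (execChunk f h ρ' b) := by
  have hrad0 : 0 < p.radius := lt_min hcu (by positivity)
  have hsp : 0 < p.spread := by unfold StabParams.spread; positivity
  have hA : 1 ≤ 1 + 4 * p.cγ * p.cβ * (1 + p.RK) := by
    have : 0 ≤ 4 * p.cγ * p.cβ * (1 + p.RK) := by positivity
    linarith
  have hB : 1 ≤ 1 + p.spread + p.RK := by linarith
  have hε0 : (0 : ℝ) ≤ ε := ε.2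
  -- With this value `U`, both the state bound `3 cγ cβ U` and the input bound `U + 3 RK cγ cβ U`
  -- are at most `ε`.
  have hpert : p.pert (p.actRadius ε) = ε / (1 + 4 * p.cγ * p.cβ * (1 + p.RK)) := by
    unfold StabParams.pert StabParams.actRadius
    field_simp
  have hU0 : 0 ≤ p.pert (p.actRadius ε) := by rw [hpert]; positivity
  have hUε : p.pert (p.actRadius ε) * (1 + 4 * p.cγ * p.cβ * (1 + p.RK)) = ε := by
    rw [hpert]; field_simp
  have hr0 : 0 ≤ p.actRadius ε := by unfold StabParams.actRadius; positivity
  have hr1 : p.actRadius ε ≤ 1 := by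
    unfold StabParams.actRadius
    exact div_le_one_of_le₀ ((show (ε : ℝ) ≤ 1 by exact_mod_cast hε1.le).trans
      (one_le_mul_of_one_le_of_one_le hA hB)) (by positivity)
  have hUle : p.pert (p.actRadius ε) ≤ p.radius := by
    rw [hpert]
    exact (div_le_self hε0 hA).trans hεr
  set U := p.pert (p.actRadius ε)
  have hd := hobs.2
  rw [obsChunk_last hτobs, obsChunk_last hτobs] at hd
  obtain ⟨h1, h2, h3⟩ := chunk_close hcu hcξ hcγ hcβ hL hRK (hstable h)
    (fun k => by
      rw [rollout_eq_stateAt hdyn hcons h k.2.le]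
      exact (applyCtrl_stateAt hcons h k).1)
    (fun k => hK _) hr0 hr1 hUle hd hb hτc
  have hx : 0 ≤ p.cγ * p.cβ * U := by positivity
  have hxK : 0 ≤ p.cγ * p.cβ * p.RK * U := by positivity
  refine ⟨fun k hk => ?_, fun k hk => ?_, ?_⟩
  · rw [add_assoc, stateAt_execChunk f h.2 _ _ (Nat.succ_le_of_lt hk),
      ← rollout_eq_stateAt hdyn hcons h (Nat.succ_le_of_lt hk)]
    refine (h1 (k + 1) hk).trans ?_
    linarith
  · have e1 := (applyCtrl_stateAt hcons h ⟨k, hk⟩).2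
    have e2 := inputAt_execChunk f h.2 ρ' b ⟨k, hk⟩
    simp only at e1 e2
    rw [← e1, e2, ← rollout_eq_stateAt hdyn hcons h hk.le]
    refine (h2 ⟨k, hk⟩).trans ?_
    linarith
  · rw [stateAt_execChunk f h.2 _ _ le_rfl, ← rollout_eq_stateAt hdyn hcons h le_rfl]
    exact h3

/-! ### The coupling of the expert with the policy -/

theorem measurableSet_chunkClose {dx du n : ℕ} (ε : ℝ≥0) (d : ℝ) (τ h : ℕ) :
    MeasurableSet {z : Traj dx du n × Traj dx du n | ChunkClose ε d τ h z.1 z.2} := by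
  have hs : ∀ t, Measurable fun z : Traj dx du n × Traj dx du n =>
      ‖stateAt z.1 t - stateAt z.2 t‖ := fun t =>
    (((measurable_stateAt t).comp measurable_fst).sub
      ((measurable_stateAt t).comp measurable_snd)).norm
  have hi : ∀ t, Measurable fun z : Traj dx du n × Traj dx du n =>
      ‖inputAt z.1 t - inputAt z.2 t‖ := fun t =>
    (((measurable_inputAt t).comp measurable_fst).sub
      ((measurable_inputAt t).comp measurable_snd)).norm
  refine MeasurableSet.inter ?_ (MeasurableSet.inter ?_ (measurableSet_le (hs _) measurable_const))
  · exact measurableSet_setOfPred.2 <| Measurable.forall fun k => Measurable.forall fun _ =>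
      measurableSet_setOfPred.1 (measurableSet_le (hs _) measurable_const)
  · exact measurableSet_setOfPred.2 <| Measurable.forall fun k => Measurable.forall fun _ =>
      measurableSet_setOfPred.1 (measurableSet_le (hi _) measurable_const)

/-- Chunk `m` overwrites only states after time `m * τ` and inputs from time `m * τ` on, while chunk
`h` has ended by then. -/
theorem ChunkClose.execChunk_iff {dx du n τ : ℕ} (f : Vec dx → Vec du → Vec dx) {ε : ℝ≥0} {d : ℝ}
    {h m : ℕ} (hm : h < m) (ρ ρ' : Traj dx du n) (b : CompAct dx du τ) :
    ChunkClose ε d τ h ρ (execChunk f m ρ' b) ↔ ChunkClose ε d τ h ρ ρ' := by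
  have hmul : h * τ + τ ≤ m * τ := by
    rw [← Nat.succ_mul]; exact Nat.mul_le_mul_right _ hm
  unfold ChunkClose
  refine and_congr (forall₂_congr fun k hk => ?_) (and_congr (forall₂_congr fun k hk => ?_) ?_)
  · rw [stateAt_execChunk_of_le f (by omega)]
  · rw [inputAt_execChunk_of_lt f (by omega)]
  · rw [stateAt_execChunk_of_le f hmul]

/-- A kernel that couples the expert's action at one observation with the imitator's action at
another one. -/
theorem exists_coupling_kernel_obs {O : Type*} [MeasurableSpace O] {dx du τ : ℕ}
    (P Q : Kernel O (CompAct dx du τ)) [IsMarkovKernel P] [IsMarkovKernel Q] {r r' : ℝ}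
    (hr : r < r' ∨ (r = 0 ∧ r' = 0)) {η : ℝ≥0∞} (hη : η ≠ 0) :
    ∃ (K : Kernel (O × O) (CompAct dx du τ × CompAct dx du τ)) (g : O → ℝ≥0∞), IsMarkovKernel K ∧
      (∀ x, (K x).map Prod.fst = P x.1) ∧ (∀ x, (K x).map Prod.snd = Q x.2) ∧ Measurable g ∧
      (∀ o, g o ≤ otProb r (P o) (Q o) + η) ∧
      ∀ x, K x {z | r' < (dMax z.1 z.2 : ℝ)} ≤
        g x.1 + ENNReal.ofReal (tvDist (Q x.1) (Q x.2)) := by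
  obtain ⟨K₁, hK₁, h1, h2, h3⟩ := exists_coupling_kernel_otProb P Q hr hη
  obtain ⟨K, hK, k1, k2, k3⟩ := exists_coupling_kernel_tvDist
    (P := P.comap Prod.fst (measurable_fst (β := O)))
    (Q := Q.comap Prod.fst (measurable_fst (β := O)))
    (Q' := Q.comap Prod.snd (measurable_snd (α := O)))
    (K := K₁.comap Prod.fst (measurable_fst (β := O))) (fun x => h1 x.1) (fun x => h2 x.1)
  -- `g` is the failure probability of the selected coupling. It is measurable as a kernel
  -- evaluation, so it stands in for `otProb`, an infimum over couplings, wherever measurability is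
  -- needed.
  exact ⟨K, fun o => K₁ o {z | r' < (dMax z.1 z.2 : ℝ)}, hK, k1, k2,
    K₁.measurable_coe (measurableSet_lt_dMax _), h3, fun x => k3 x _ (measurableSet_lt_dMax _)⟩

theorem fst_expertChunkLaw {dx du H τ : ℕ} (τobs : ℕ) (D : Measure (Traj dx du (H * τ)))
    {synth : Traj dx du (H * τ) → Fin (H * τ) → PrimCtrl dx du} (hsynth : Measurable synth)
    (h : Fin H) :
    (expertChunkLaw τobs D synth h).fst = D.map (obsChunk τ τobs h) := by
  have hact : Measurable fun ρ => chunkAct h (synth ρ) :=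
    measurable_pi_lambda _ fun k => (measurable_pi_apply _).comp hsynth
  rw [Measure.fst, expertChunkLaw,
    Measure.map_map measurable_fst ((measurable_obsChunk τ τobs h).prodMk hact)]
  rfl

/-- Passing from a coupling of the expert with the first `h` chunks of the policy to one with the
first `h + 1` chunks. -/
theorem exists_coupling_succ {dx du H τ τobs : ℕ} {f : Vec dx → Vec du → Vec dx}
    (hf : Measurable (Function.uncurry f)) {D : Measure (Traj dx du (H * τ))}
    [IsProbabilityMeasure D] {synth : Traj dx du (H * τ) → Fin (H * τ) → PrimCtrl dx du}
    (hsynth : Measurable synth) {πstar πhat : ChunkPolicy dx du H τ τobs}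
    [∀ h, IsMarkovKernel (πstar h)] [∀ h, IsMarkovKernel (πhat h)]
    (hπstar : ∀ h : Fin H, (expertChunkLaw τobs D synth h).IsCondKernel (πstar h))
    {γ : ℝ≥0 → ℝ≥0} (hγ : Monotone γ) (hπhat : IsTVC γ πhat) {ε : ℝ≥0} {d r r' : ℝ}
    (hr : r < r' ∨ (r = 0 ∧ r' = 0)) {η : ℝ≥0∞} (hη : η ≠ 0)
    (hclose : ∀ᵐ ρ ∂D, ∀ (h : Fin H) ρ' b,
      ObsClose ε d (obsChunk τ τobs h ρ) (obsChunk τ τobs h ρ') →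
      (dMax (chunkAct h (synth ρ)) b : ℝ) ≤ r' → ChunkClose ε d τ h ρ (execChunk f h ρ' b))
    (ν₀ : Measure (Vec dx)) (h : Fin H)
    {ν : Measure (Traj dx du (H * τ) × Traj dx du (H * τ))}
    (hν : IsCoupling ν D (partialLaw f ν₀ πhat h)) :
    ∃ ν', IsCoupling ν' D (partialLaw f ν₀ πhat (h + 1)) ∧
      ν' {z | ¬ ChunkClose ε d τ h z.1 z.2} ≤
        ν {z | ¬ ObsClose ε d (obsChunk τ τobs h z.1) (obsChunk τ τobs h z.2)} +
          ((γ ε : ℝ≥0∞) + ∫⁻ o, otProb r (πstar h o) (πhat h o)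
            ∂(expertChunkLaw τobs D synth h).fst + η) := by
  have := hν.isProbabilityMeasure
  have hobs := measurable_obsChunk (dx := dx) (du := du) (n := H * τ) τ τobs h
  have hact : Measurable fun ρ => chunkAct h (synth ρ) :=
    measurable_pi_lambda _ fun k => (measurable_pi_apply _).comp hsynth
  have hfst := fst_expertChunkLaw τobs D hsynth h
  obtain ⟨K, g, hK, hK1, hK2, hg, hgle, hKbad⟩ :=
    exists_coupling_kernel_obs (πstar h) (πhat h) hr hη
  have : StandardBorelSpace (CompAct dx du τ) := StandardBorelSpace.pi_countable
  obtain ⟨μ, hμ1, hμ2, hμ3⟩ := exists_step hν.1 hobs hact hobs (π := πstar h) (π' := πhat h)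
    (by
      have := (hπstar h).disintegrate
      rw [hfst] at this
      exact this.symm) hK1 hK2
  have hexec := measurable_execChunk (n := H * τ) (τ := τ) hf h
  let e : Traj dx du (H * τ) × (Traj dx du (H * τ) × CompAct dx du τ) →
      Traj dx du (H * τ) × Traj dx du (H * τ) := fun y => (y.1, execChunk f h y.2.1 y.2.2)
  have he : Measurable e := measurable_fst.prodMk (hexec.comp measurable_snd)
  refine ⟨μ.map e, ⟨?_, ?_⟩, ?_⟩
  · rw [Measure.map_map measurable_fst he]; exact hμ1
  · rw [Measure.map_map measurable_snd he, partialLaw, dif_pos h.2, ← hν.2, ← hμ2,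
      Measure.map_map hexec measurable_snd]
    rfl
  have hOC : MeasurableSet {z : Traj dx du (τobs - 1) × Traj dx du (H * τ) |
      ObsClose ε d z.1 (obsChunk τ τobs h z.2)} :=
    (measurable_fst.prodMk (hobs.comp measurable_snd)) (measurableSet_obsClose ε d)
  have hOC' : MeasurableSet {z : Traj dx du (H * τ) × Traj dx du (H * τ) |
      ObsClose ε d (obsChunk τ τobs h z.1) (obsChunk τ τobs h z.2)} :=
    ((hobs.comp measurable_fst).prodMk (hobs.comp measurable_snd)) (measurableSet_obsClose ε d)
  -- The failure event: if the observations are close, then the actions are far apart. It involves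
  -- the expert only through its observation and its action, as the identity from `exists_step`
  -- requires.
  let S : Set ((Traj dx du (τobs - 1) × Traj dx du (H * τ)) ×
      (CompAct dx du τ × CompAct dx du τ)) :=
    {y | ObsClose ε d y.1.1 (obsChunk τ τobs h y.1.2) → r' < (dMax y.2.1 y.2.2 : ℝ)}
  have hS : MeasurableSet S :=
    (measurable_fst hOC).imp (measurable_snd (measurableSet_lt_dMax r'))
  calc μ.map e {z | ¬ ChunkClose ε d τ h z.1 z.2}
      = μ (e ⁻¹' {z | ¬ ChunkClose ε d τ h z.1 z.2}) :=
        Measure.map_apply he (measurableSet_chunkClose ε d τ h).compl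
    _ ≤ μ {y | ((obsChunk τ τobs h y.1, y.2.1), (chunkAct h (synth y.1), y.2.2)) ∈ S} := by
        refine measure_mono_ae ?_
        rw [← hμ1] at hclose
        filter_upwards [ae_of_ae_map measurable_fst.aemeasurable hclose] with y hy hbad hobs
        by_contra hle
        exact hbad (hy h _ _ hobs (not_lt.1 hle))
    _ = ∫⁻ z, K (obsChunk τ τobs h z.1, obsChunk τ τobs h z.2)
          {q | ((obsChunk τ τobs h z.1, z.2), q) ∈ S} ∂ν := hμ3 S hS
    _ ≤ ∫⁻ z, ({z : Traj dx du (H * τ) × Traj dx du (H * τ) |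
          ¬ ObsClose ε d (obsChunk τ τobs h z.1) (obsChunk τ τobs h z.2)}.indicator 1 z +
          (g (obsChunk τ τobs h z.1) + (γ ε : ℝ≥0∞))) ∂ν := by
        refine lintegral_mono fun z => ?_
        by_cases hz : ObsClose ε d (obsChunk τ τobs h z.1) (obsChunk τ τobs h z.2)
        · have hset : {q : CompAct dx du τ × CompAct dx du τ |
              ((obsChunk τ τobs h z.1, z.2), q) ∈ S} = {q | r' < (dMax q.1 q.2 : ℝ)} := by
            ext q; simp [S, hz]
          simp only [hset]
          refine ((hKbad _).trans ?_).trans le_add_self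
          refine add_le_add le_rfl (ENNReal.ofReal_le_of_le_toReal ?_)
          refine (hπhat h _ _).trans ?_
          exact_mod_cast hγ hz.1
        · have : z ∈ {z : Traj dx du (H * τ) × Traj dx du (H * τ) |
              ¬ ObsClose ε d (obsChunk τ τobs h z.1) (obsChunk τ τobs h z.2)} := hz
          rw [Set.indicator_of_mem this]
          exact prob_le_one.trans le_self_add
    _ = ν {z | ¬ ObsClose ε d (obsChunk τ τobs h z.1) (obsChunk τ τobs h z.2)} +
          (∫⁻ o, g o ∂(D.map (obsChunk τ τobs h)) + γ ε) := by
        have hB : MeasurableSet {z : Traj dx du (H * τ) × Traj dx du (H * τ) |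
            ¬ ObsClose ε d (obsChunk τ τobs h z.1) (obsChunk τ τobs h z.2)} := hOC'.compl
        rw [lintegral_add_left (measurable_one.indicator hB), lintegral_indicator_one hB,
          lintegral_add_right _ measurable_const,
          lintegral_const, measure_univ, mul_one, ← hν.1, Measure.map_map hobs measurable_fst,
          lintegral_map hg (hobs.comp measurable_fst)]
        rfl
    _ ≤ _ := by
        have : IsProbabilityMeasure (D.map (obsChunk τ τobs h)) :=
          Measure.isProbabilityMeasure_map hobs.aemeasurable
        have : ∫⁻ o, g o ∂(D.map (obsChunk τ τobs h)) ≤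
            ∫⁻ o, otProb r (πstar h o) (πhat h o) ∂(D.map (obsChunk τ τobs h)) + η := by
          refine (lintegral_mono hgle).trans ?_
          rw [lintegral_add_right _ measurable_const, lintegral_const, measure_univ, mul_one]
        rw [hfst]
        refine add_le_add le_rfl ((add_le_add this le_rfl).trans (le_of_eq ?_))
        ring

/-- Later chunks of the policy do not change what happened during chunk `h`. -/
theorem exists_coupling_extend {dx du H τ τobs : ℕ} {f : Vec dx → Vec du → Vec dx}
    (hf : Measurable (Function.uncurry f)) {D : Measure (Traj dx du (H * τ))}
    [IsProbabilityMeasure D] {π : ChunkPolicy dx du H τ τobs} [∀ h, IsMarkovKernel (π h)]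
    {ε : ℝ≥0} {d : ℝ} {ν₀ : Measure (Vec dx)} {h m : ℕ} (hm : h + 1 ≤ m)
    {ν : Measure (Traj dx du (H * τ) × Traj dx du (H * τ))}
    (hν : IsCoupling ν D (partialLaw f ν₀ π (h + 1))) :
    ∃ ν', IsCoupling ν' D (partialLaw f ν₀ π m) ∧
      ν' {z | ¬ ChunkClose ε d τ h z.1 z.2} = ν {z | ¬ ChunkClose ε d τ h z.1 z.2} := by
  induction m, hm using Nat.le_induction with
  | base => exact ⟨ν, hν, rfl⟩
  | succ m hm ih =>
    obtain ⟨ν', hν', heq⟩ := ih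
    by_cases hmH : m < H
    · have := hν'.isProbabilityMeasure
      have hobs := measurable_obsChunk (dx := dx) (du := du) (n := H * τ) τ τobs m
      have hexec := measurable_execChunk (n := H * τ) (τ := τ) hf m
      let κ := (π ⟨m, hmH⟩).comap (fun ρ : Traj dx du (H * τ) => obsChunk τ τobs m ρ) hobs
      -- The later action is drawn from the policy given the second component alone; the expert
      -- trajectory is left in place.
      let N := ν' ⊗ₘ κ.comap (Prod.snd : Traj dx du (H * τ) × Traj dx du (H * τ) → _)
        measurable_snd
      let e : (Traj dx du (H * τ) × Traj dx du (H * τ)) × CompAct dx du τ →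
        Traj dx du (H * τ) × Traj dx du (H * τ) := fun y => (y.1.1, execChunk f m y.1.2 y.2)
      have hs : Measurable fun y : (Traj dx du (H * τ) × Traj dx du (H * τ)) × CompAct dx du τ =>
        (y.1.2, y.2) := measurable_fst.snd.prodMk measurable_snd
      have he : Measurable e := measurable_fst.fst.prodMk (hexec.comp hs)
      have hN : N.map Prod.fst = ν' := by
        rw [← Measure.fst, Measure.fst_compProd]
      refine ⟨N.map e, ⟨?_, ?_⟩, ?_⟩
      · rw [Measure.map_map measurable_fst he, ← hν'.1]
        conv_rhs => rw [← hN, Measure.map_map measurable_fst measurable_fst]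
        rfl
      · rw [Measure.map_map measurable_snd he, partialLaw, dif_pos hmH, ← hν'.2,
          ← map_compProd_comap ν' measurable_snd κ, Measure.map_map hexec hs]
        rfl
      · have hC := (measurableSet_chunkClose (dx := dx) (du := du) (n := H * τ) ε d τ h).compl
        rw [← heq]
        conv_rhs => rw [← hN]
        change N.map e {z | ChunkClose ε d τ h z.1 z.2}ᶜ =
          N.map Prod.fst {z | ChunkClose ε d τ h z.1 z.2}ᶜ
        rw [Measure.map_apply he hC, Measure.map_apply measurable_fst hC]
        congr 1
        ext y
        exact not_congr (ChunkClose.execChunk_iff f hm _ _ _)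
    · refine ⟨ν', ?_, heq⟩
      rwa [partialLaw, dif_neg hmH]

/-- The probabilistic half of the theorem: stability enters only through `hclose`, and the tolerance
`d` for current states is reproduced at the end of each chunk. -/
theorem margLoss_policyLaw_le {dx du H τ τobs : ℕ} (hτobs : 1 ≤ τobs) (hτ : τobs ≤ τ)
    {f : Vec dx → Vec du → Vec dx} (hf : Measurable (Function.uncurry f))
    {D : Measure (Traj dx du (H * τ))} [IsProbabilityMeasure D]
    {synth : Traj dx du (H * τ) → Fin (H * τ) → PrimCtrl dx du} (hsynth : Measurable synth)
    {πstar πhat : ChunkPolicy dx du H τ τobs}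
    [∀ h, IsMarkovKernel (πstar h)] [∀ h, IsMarkovKernel (πhat h)]
    (hπstar : ∀ h : Fin H, (expertChunkLaw τobs D synth h).IsCondKernel (πstar h))
    {γ : ℝ≥0 → ℝ≥0} (hγ : Monotone γ) (hπhat : IsTVC γ πhat) {ε : ℝ≥0} {d r r' : ℝ}
    (hd : 0 ≤ d) (hr : r < r' ∨ (r = 0 ∧ r' = 0))
    (hclose : ∀ᵐ ρ ∂D, ∀ (h : Fin H) ρ' b,
      ObsClose ε d (obsChunk τ τobs h ρ) (obsChunk τ τobs h ρ') →
      (dMax (chunkAct h (synth ρ)) b : ℝ) ≤ r' → ChunkClose ε d τ h ρ (execChunk f h ρ' b)) :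
    margLoss ε D (policyLaw f D πhat) ≤
      (H : ℝ≥0∞) * (γ ε : ℝ≥0∞) +
        ∑ h : Fin H, ∫⁻ o, otProb r (πstar h o) (πhat h o)
          ∂(expertChunkLaw τobs D synth h).fst := by
  set ν₀ : Measure (Vec dx) := D.map fun ρ => ρ.1 0 with hν₀
  have hx0 : Measurable fun ρ : Traj dx du (H * τ) => ρ.1 0 :=
    (measurable_pi_apply _).comp measurable_fst
  have hinit : Measurable (initTraj (dx := dx) (du := du) (H * τ)) := by
    refine Measurable.prodMk (measurable_pi_lambda _ fun t => ?_) measurable_const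
    split_ifs
    · exact measurable_id
    · exact measurable_const
  set E : Fin H → ℝ≥0∞ := fun h => ∫⁻ o, otProb r (πstar h o) (πhat h o)
    ∂(expertChunkLaw τobs D synth h).fst with hE
  refine ENNReal.le_of_forall_pos_le_add fun δ hδ _ => ?_
  set η : ℝ≥0∞ := (δ : ℝ≥0∞) / (H + 1) with hη
  have hη0 : η ≠ 0 := ENNReal.div_ne_zero.2 ⟨by simpa using hδ.ne', by finiteness⟩
  -- The cost of chunk `i`. Each selection of couplings loses `η`, and the `H` losses together stay
  -- below `δ`, which is arbitrary.
  let c : ℕ → ℝ≥0∞ := fun i => if hi : i < H then (γ ε : ℝ≥0∞) + E ⟨i, hi⟩ + η else 0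
  have hind : ∀ m ≤ H, ∃ ν, IsCoupling ν D (partialLaw f ν₀ πhat m) ∧
      ν {z | ¬ ObsClose ε d (obsChunk τ τobs m z.1) (obsChunk τ τobs m z.2)} ≤
        ∑ i ∈ range m, c i := by
    intro m
    induction m with
    | zero =>
      intro _
      have hpair : Measurable fun ρ : Traj dx du (H * τ) => (ρ, initTraj (H * τ) (ρ.1 0)) :=
        measurable_id.prodMk (hinit.comp hx0)
      have hobs := measurable_obsChunk (dx := dx) (du := du) (n := H * τ) τ τobs 0
      refine ⟨D.map fun ρ => (ρ, initTraj (H * τ) (ρ.1 0)), ⟨?_, ?_⟩, ?_⟩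
      · rw [Measure.map_map measurable_fst hpair]; exact Measure.map_id
      · rw [Measure.map_map measurable_snd hpair, partialLaw, hν₀, Measure.map_map hinit hx0]; rfl
      · have hOC : MeasurableSet {z : Traj dx du (H * τ) × Traj dx du (H * τ) |
            ¬ ObsClose ε d (obsChunk τ τobs 0 z.1) (obsChunk τ τobs 0 z.2)} :=
          (((hobs.comp measurable_fst).prodMk (hobs.comp measurable_snd))
            (measurableSet_obsClose ε d)).compl
        rw [Measure.map_apply hpair hOC]
        refine le_of_eq_of_le ?_ zero_le
        convert measure_empty (μ := D)
        ext ρ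
        simpa using obsClose_initTraj hτobs hd ρ
    | succ m ih =>
      intro hm
      obtain ⟨ν, hν, hle⟩ := ih (by omega)
      obtain ⟨ν', hν', hle'⟩ := exists_coupling_succ hf hsynth hπstar hγ hπhat hr hη0 hclose ν₀
        ⟨m, hm⟩ hν
      refine ⟨ν', hν', le_trans (measure_mono ?_) (hle'.trans ?_)⟩
      · exact fun z hz hc => hz (hc.obsClose hτobs hτ)
      rw [sum_range_succ]
      refine add_le_add hle (le_of_eq ?_)
      simp only [c]
      rw [dif_pos (show m < H from hm)]
  have hsum : ∀ m ≤ H, ∑ i ∈ range m, c i ≤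
      (H : ℝ≥0∞) * (γ ε : ℝ≥0∞) + ∑ h, E h + δ := fun m hm => by
    calc ∑ i ∈ range m, c i ≤ ∑ i ∈ range H, c i :=
          sum_le_sum_of_subset (range_subset_range.2 hm)
      _ = ∑ h : Fin H, ((γ ε : ℝ≥0∞) + E h + η) := by
          rw [sum_range]
          exact sum_congr rfl fun h _ => dif_pos h.2
      _ = (H : ℝ≥0∞) * (γ ε : ℝ≥0∞) + ∑ h, E h + H * η := by
          simp [sum_add_distrib]
      _ ≤ _ := by
          gcongr
          calc (H : ℝ≥0∞) * η ≤ (H + 1) * η := by gcongr; exact le_self_add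
            _ ≤ δ := ENNReal.mul_div_le
  refine iSup_le fun t => ?_
  have hτ0 : 0 < τ := by omega
  have hh : (t : ℕ) / τ < H := Nat.div_lt_of_lt_mul (t.2.trans_eq (Nat.mul_comm _ _))
  -- For time `t`: couple up to the start of its chunk `t / τ`, play that chunk, and let the policy
  -- finish freely.
  obtain ⟨ν, hν, hle⟩ := hind (t / τ) hh.le
  obtain ⟨ν', hν', hle'⟩ := exists_coupling_succ hf hsynth hπstar hγ hπhat hr hη0 hclose ν₀
    ⟨t / τ, hh⟩ hν
  obtain ⟨ν'', hν'', heq⟩ := exists_coupling_extend (ε := ε) (d := d) hf (Nat.succ_le_of_lt hh) hν'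
  refine (iInf₂_le ν'' hν'').trans (le_trans ?_ (hsum _ (Nat.succ_le_of_lt hh)))
  rw [sum_range_succ]
  refine (measure_mono ?_).trans (heq.trans_le (hle'.trans (add_le_add hle (le_of_eq ?_))))
  · intro z hz hc
    have hmod := Nat.mod_lt (t : ℕ) hτ0
    have hdm : (t : ℕ) / τ * τ + (t : ℕ) % τ = t := by
      rw [mul_comm]; exact Nat.div_add_mod _ _
    have h1 := hc.1 _ hmod
    have h2 := hc.2.1 _ hmod
    simp only [hdm] at h1 h2
    have ht := t.2
    simp only [stateAt, inputAt, dif_pos ht, dif_pos (Nat.succ_lt_succ ht)] at h1 h2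
    exact absurd hz (not_lt.2 (max_le h1 h2))
  · simp only [c]
    rw [dif_pos hh]

/-! ### The constants and the conclusion -/

theorem StabParams.c1_pos {p : StabParams} (hγ : 0 < p.cγ) (hβ : 0 < p.cβ) (hcu : 0 < p.cu)
    (hξ : 0 < p.cξ) (hRK : 0 ≤ p.RK) (hR : 0 ≤ p.Rdyn) : 0 < p.c1 := by
  have hrad0 : 0 < p.radius := lt_min hcu (by positivity)
  have hsp : 0 < p.spread := by unfold StabParams.spread; positivity
  unfold StabParams.c1
  positivity

/-- The second factor of `c1` exceeds `1 + spread + RK` by `1 + 2 Rdyn > 0`. This strict gap is the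
room for the discretization in the measurable selection. -/
theorem StabParams.div_c1_lt_actRadius {p : StabParams} (hγ : 0 < p.cγ) (hβ : 0 < p.cβ)
    (hcu : 0 < p.cu) (hξ : 0 < p.cξ) (hRK : 0 ≤ p.RK) (hR : 0 ≤ p.Rdyn) {ε : ℝ} (hε : 0 < ε) :
    ε / p.c1 < p.actRadius ε := by
  have hrad0 : 0 < p.radius := lt_min hcu (by positivity)
  have hsp : 0 < p.spread := by unfold StabParams.spread; positivity
  unfold StabParams.c1 StabParams.actRadius
  refine div_lt_div_of_pos_left hε (by positivity) (mul_lt_mul_of_pos_left ?_ (by positivity))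
  linarith

theorem mainTheorem2 (dx du H τ τobs : ℕ) (hτobs : 1 ≤ τobs) (hτ : τobs ≤ τ)
    (f : Vec dx → Vec du → Vec dx) (hf : Measurable (Function.uncurry f))
    (D : Measure (Traj dx du (H * τ))) [IsProbabilityMeasure D]
    (hD : ∀ᵐ ρ ∂D, ∀ t : Fin (H * τ), ρ.1 t.succ = f (ρ.1 t.castSucc) (ρ.2 t))
    (synth : Traj dx du (H * τ) → Fin (H * τ) → PrimCtrl dx du) (hsynth : Measurable synth)
    (p : StabParams) (hp : StabilityAssumption f D synth p)
    (πstar : ChunkPolicy dx du H τ τobs) [∀ h, IsMarkovKernel (πstar h)]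
    (hπstar : ∀ h : Fin H, (expertChunkLaw τobs D synth h).IsCondKernel (πstar h))
    (πhat : ChunkPolicy dx du H τ τobs) [∀ h, IsMarkovKernel (πhat h)]
    (γ : ℝ≥0 → ℝ≥0) (hγ : Monotone γ) (hπhat : IsTVC γ πhat)
    (ε : ℝ≥0) (hε : (ε : ℝ) < p.c2) (hτc : p.c3 ≤ (τ : ℝ)) :
    margLoss ε D (policyLaw f D πhat) ≤
        (H : ℝ≥0∞) * (γ ε : ℝ≥0∞) +
          ∑ h : Fin H, ∫⁻ o, otProb ((ε : ℝ) / p.c1) (πstar h o) (πhat h o)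
            ∂(expertChunkLaw τobs D synth h).fst ∧
    (0 < ε →
      ∑ h : Fin H, ∫⁻ o, otProb ((ε : ℝ) / p.c1) (πstar h o) (πhat h o)
            ∂(expertChunkLaw τobs D synth h).fst ≤
        ENNReal.ofReal (p.c1 / ε) *
          ∑ h : Fin H, ∫⁻ o, wass1 (πstar h o) (πhat h o)
            ∂(expertChunkLaw τobs D synth h).fst) := by
  rcases Nat.eq_zero_or_pos H with rfl | hH
  · refine ⟨?_, fun _ => by simp⟩
    refine iSup_le fun t => absurd t.2 (by simp)
  have hτ0 : 0 < τ := by omega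
  -- The signs of `Rdyn` and `RK` are not assumed; they follow from one trajectory satisfying the
  -- bounds, using that for `H > 0` there is at least one gain.
  obtain ⟨ρ₀, hρ₀⟩ := (hp.states_bounded.and hp.gains_bounded).exists
  have hRdyn : 0 ≤ p.Rdyn := (norm_nonneg _).trans (hρ₀.1 0)
  have hRK : 0 ≤ p.RK := (norm_nonneg _).trans (hρ₀.2 ⟨0, Nat.mul_pos hH hτ0⟩)
  have hc1 := StabParams.c1_pos hp.cγ_pos hp.cβ_pos hp.cu_pos hp.cξ_pos hRK hRdyn
  have hrad0 : 0 < p.radius := lt_min hp.cu_pos (div_pos hp.cξ_pos (by linarith [hp.cγ_pos]))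
  have hε1 : ε < 1 := by exact_mod_cast hε.trans_le (min_le_left _ _)
  have hεr : (ε : ℝ) ≤ p.radius := (hε.trans_le (min_le_right _ _)).le.trans
    (div_le_self hrad0.le (le_max_left _ _))
  refine ⟨?_, fun hε0 => ?_⟩
  · refine margLoss_policyLaw_le hτobs hτ hf hsynth hπstar hγ hπhat
      (d := 2 * p.cγ * p.pert (p.actRadius ε)) (r' := p.actRadius ε) ?_ ?_ ?_
    · have h1 := hp.cγ_pos
      have h2 := hp.cβ_pos
      have h3 := hp.cξ_pos
      have hsp : 0 < p.spread := by unfold StabParams.spread; positivity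
      unfold StabParams.pert StabParams.actRadius
      positivity
    -- For `ε = 0` both radii are `0`, and the exact total variation coupling is used; otherwise
    -- there is a strict gap.
    · rcases eq_or_lt_of_le (zero_le (a := ε)) with h0 | h0
      · right
        simp [← h0, StabParams.actRadius]
      · left
        exact StabParams.div_c1_lt_actRadius hp.cγ_pos hp.cβ_pos hp.cu_pos hp.cξ_pos hRK hRdyn
          (by exact_mod_cast h0)
    · filter_upwards [hD, hp.consistent, hp.stable, hp.gains_bounded] with ρ h1 h2 h3 h4 h ρ' b ho hb
      exact chunkClose_execChunk hτobs hp.cu_pos hp.cξ_pos hp.cγ_pos hp.cβ_pos hp.L_pos hRK hε1 hεr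
        hτc h1 h2 h3 h4 h ho hb
  · rw [mul_sum]
    refine sum_le_sum fun h _ => ?_
    rw [← lintegral_const_mul' _ _ ENNReal.ofReal_ne_top]
    refine lintegral_mono fun o => ?_
    have h0 : (0 : ℝ) < ε / p.c1 := div_pos (by exact_mod_cast hε0) hc1
    simpa only [inv_div] using otProb_le_wass1 h0 (πstar h o) (πhat h o)
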